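/- **Setting.** Let $\mathcal G$ be a directed acyclic graph on a finite set of real-valued variables: observed variables $V=\{Z,A,Y\}\cup C\cup M$ (with $C$ a finite set of covariates, $M$ a finite set of mediators, $Z\notin C$, and $A$ a treatment with values in $\{0,1\}$) and the remaining, latent, variables $U$, which are otherwise unrestricted. Let $P$ be the distribution of a causal model of $\mathcal G$: every variable $v$ has a conditional density $P(v\mid \mathrm{pa}(v))$ given its parents with respect to some $\sigma$-finite reference measure (counting measure on $\{0,1\}$ for $A$), the joint density is $\prod_v P(v\mid\mathrm{pa}(v))$, and the density under $do(S=s)$ is $\prod_{v\notin S}P(v\mid \mathrm{pa}(v))|_{S=s}$. Sums below are integrals against the reference measures. Assume that the density $P(V)$ of the observed variables is strictly positive and that $\mathbb E[|Y|\mid do(A=a)]<\infty$ for $a=0,1$, and put $\theta=\mathbb E[Y\mid do(A=1)]-\mathbb E[Y\mid do(A=0)]$. For disjoint $S,B\subseteq V$, the constraint "$X\perp\!\!\!\perp Y'\mid W$ in $P(V)/P(S\mid B)$" means that, for almost every value $s$ of $S$, $X$ and $Y'$ are conditionally independent given $W$ under the density $P(V)/P(S\mid B)|_{S=s}$ of $V\setminus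 S$. **Assumptions.** 1. (Faithfulness) For all disjoint $X,Y',W\subseteq V$, $X\perp\!\!\!\perp Y'\mid W$ in $P$ implies that $X$ and $Y'$ are d-separated given $W$ in $\mathcal G$. (Verma faithfulness) If the Verma constraint $Y\perp\!\!\!\perp Z\mid C$ in $P(V)/P(M\mid A,Z,C)$ holds, then the edges of $\mathcal G$ are such that $P(V\setminus M\mid do(m))=P(V)/P(M\mid A,Z,C)|_{M=m}$, that is, this identity holds in every causal model of $\mathcal G$ with positive observed density, and $Y$ and $Z$ are d-separated given $C$ in the graph $\mathcal G_{do(m)}$, in which the edges into $M$ are removed and $M$ is fixed (fixed vertices block every path through them). 2. $\mathcal G$ has a topological ordering with $\{Z\}\cup C<A<M<Y$. 3. $\mathcal G$ contains the edges $Z\to A\to M\to Y$: an edge $Z\to A$, an edge from $A$ to an element of $M$, and an edge from an element of $M$ to $Y$. 4. Every latent variable that causes an element of $M$ also causes $Y$, where "$u$ causes $v$" means that there is a directed path from $u$ to $v$ with no observed variable strictly inside it (if the latent variables have no parents, this is the edge $u\to v$). Let $\beta_1,\beta_2,\beta_3$ be parameters that are zero if and only if, respectively, $Y\perp\!\!\!\perp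 Z\mid A,C$ in $P$; $Y\perp\!\!\!\perp Z\mid C$ in $P(V)/P(M\mid A,Z,C)$; $M\perp\!\!\!\perp Z\mid A,C$ in $P$. **Conclusion.** * If $\beta_1=0$, then $\theta=\sum_{c}P(c)\,\big(\mathbb E[Y\mid A=1,c]-\mathbb E[Y\mid A=0,c]\big)$. * If $\beta_2=0$, then, with $L=C\cup\{Z\}$, $\theta=\sum_{m,l}\Big(\sum_{a'}P(a',l)\,\mathbb E[Y\mid a',m,l]\Big)\big(P(m\mid A=1,l)-P(m\mid A=0,l)\big)$. * Suppose that $\beta_2=\beta_3=0$, that $Z$ takes each of the values $0$ and $1$ with positive probability, that the treatment effect is homogeneous, i.e. $\mathbb E[Y\mid do(A=1),W=w]-\mathbb E[Y\mid do(A=0),W=w]$ is the same for almost every value $w$ of the set $W$ of all (observed and latent) non-descendants of $A$, and that the denominator below is non-zero. Then $$\theta=\frac{\sum_{c}P(c)\,\big(\mathbb E[Y\mid Z=1,c]-\mathbb E[Y\mid Z=0,c]\big)}{\sum_{c}P(c)\,\big(\mathbb E[A\mid Z=1,c]-\mathbb E[A\mid Z=0,c]\big)}.$$ -/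

import Mathlib

open MeasureTheory
open scoped ENNReal NNReal

noncomputable section

namespace Causal

/-- A directed acyclic graph; `Adj u v` is the edge `u → v`. -/
structure DAG (V : Type*) where
  Adj : V → V → Prop
  acyclic : ∀ v, ¬ Relation.TransGen Adj v v

/-- `u` is an ancestor of `v`, every vertex being an ancestor of itself. -/
def DAG.Anc {V : Type*} (G : DAG V) (u v : V) : Prop := Relation.ReflTransGen G.Adj u v

/-- The graph after the intervention `do(S = s)`: all edges into `S` are removed. -/
def DAG.doGraph {V : Type*} (G : DAG V) (S : Finset V) : DAG V where
  Adj u v := G.Adj u v ∧ v ∉ S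
  acyclic v h := G.acyclic v (Relation.TransGen.mono (fun _ _ hab => hab.1) v v h)

/-- `l` is a walk of `G` (edges traversed in either direction) that is open given `W`: each
collider on it is an ancestor of some element of `W`, and no non-collider on it lies in `W`. -/
def DAG.OpenWalk {V : Type*} (G : DAG V) (W : Finset V) (l : List V) : Prop :=
  l.IsChain (fun a b => G.Adj a b ∨ G.Adj b a) ∧
  ∀ a b c, [a, b, c] <:+: l →
    ((G.Adj a b ∧ G.Adj c b) → ∃ w ∈ W, G.Anc b w) ∧
    (¬ (G.Adj a b ∧ G.Adj c b) → b ∉ W)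

/-- d-separation of `X` and `Y` given `W`. (Whether walks may repeat vertices makes no
difference: an open walk between two vertices can be shortened to an open path.) -/
def DAG.DSep {V : Type*} (G : DAG V) (X Y W : Finset V) : Prop :=
  ∀ x ∈ X, ∀ y ∈ Y, ∀ l : List V,
    l.head? = some x → l.getLast? = some y → ¬ G.OpenWalk W l

/-- `u` causes `v` by a directed path with no observed variable strictly inside it. When the
latent variables have no parents and `u` is latent, this is the edge `u → v`. -/
def DAG.Causes {V : Type*} (G : DAG V) (obs : Finset V) (u v : V) : Prop :=
  ∃ w, Relation.ReflTransGen (fun a b => G.Adj a b ∧ b ∉ obs) u w ∧ G.Adj w v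

/-- The graph has a topological ordering in which `{Z} ∪ C` comes before `A`, `A` before every
element of `M`, and every element of `M` before `Y`. -/
def DAG.Ordered {V : Type*} (G : DAG V) (Z : V) (C : Finset V) (A : V) (M : Finset V) (Y : V) :
    Prop :=
  ∃ t : V → ℕ, (∀ u v, G.Adj u v → t u < t v) ∧ t Z < t A ∧ (∀ c ∈ C, t c < t A) ∧
    (∀ m ∈ M, t A < t m) ∧ ∀ m ∈ M, t m < t Y

/-- The observed variables `Z, C, A, M, Y`; all the other vertices are latent. -/
def observed {V : Type*} [DecidableEq V] (Z : V) (C : Finset V) (A : V) (M : Finset V) (Y : V) :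
    Finset V :=
  {Z, A, Y} ∪ C ∪ M

/-! ### Densities with respect to a product of reference measures -/

/-- Integral of a real function over the coordinates in `s`, the other coordinates being those
of `x`: the Bochner analogue of `MeasureTheory.lmarginal`. For counting reference measures it is
a sum over the values of the coordinates in `s`. -/
def rmarg {V : Type*} [DecidableEq V] (μ : V → Measure ℝ) (s : Finset V)
    (g : (V → ℝ) → ℝ) (x : V → ℝ) : ℝ :=
  ∫ y : (s → ℝ), g (Function.updateFinset x s y) ∂Measure.pi (fun i : s => μ i)

/-- For `g` a density in the coordinates `N` (the coordinates outside `N` are parameters): the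
conditional mean of coordinate `v` given the coordinates in `T`. -/
def condMean {V : Type*} [DecidableEq V] (μ : V → Measure ℝ) (N : Finset V)
    (g : (V → ℝ) → ℝ≥0∞) (v : V) (T : Finset V) (x : V → ℝ) : ℝ :=
  rmarg μ (N \ T) (fun x' => x' v * (g x').toReal) x / (lmarginal μ (N \ T) g x).toReal

/-- For `g` a density in the coordinates `N` (the coordinates outside `N` are parameters):
`X` is independent of `Y` given `W`, i.e. `g(x,y,w) g(w) = g(x,w) g(y,w)`. -/
def DensityCondIndep {V : Type*} [Fintype V] [DecidableEq V] (μ : V → Measure ℝ) (N : Finset V)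
    (g : (V → ℝ) → ℝ≥0∞) (X Y W : Finset V) : Prop :=
  ∀ᵐ x ∂Measure.pi μ,
    lmarginal μ (N \ (X ∪ Y ∪ W)) g x * lmarginal μ (N \ W) g x =
      lmarginal μ (N \ (X ∪ W)) g x * lmarginal μ (N \ (Y ∪ W)) g x

/-! ### Causal models -/

/-- A causal model of the DAG `G`: real-valued variables indexed by the vertices (observed and
latent), `ref v` a reference measure for variable `v` (for example counting measure on a set
of values, or Lebesgue measure), and `kernel v x` the conditional density of variable `v` at
`x v` given that its parents take the values that they have in `x`. -/
structure CausalModel {V : Type*} [Fintype V] [DecidableEq V] (G : DAG V) where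
  ref : V → Measure ℝ
  sigmaFinite_ref : ∀ v, SigmaFinite (ref v)
  kernel : V → (V → ℝ) → ℝ≥0
  measurable_kernel : ∀ v, Measurable (kernel v)
  kernel_local : ∀ v x y, x v = y v → (∀ u, G.Adj u v → x u = y u) → kernel v x = kernel v y
  kernel_norm : ∀ v x, ∫⁻ s, (kernel v (Function.update x v s) : ℝ≥0∞) ∂ref v = 1

attribute [instance] CausalModel.sigmaFinite_ref

namespace CausalModel

/-- The truncated factorization: the density, in the coordinates outside `S`, of the distribution
of all variables under `do(S = s)`, where `s` is given by the coordinates of `x` in `S`. -/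
def doDensity {V : Type*} [Fintype V] [DecidableEq V] {G : DAG V} (P : CausalModel G)
    (S : Finset V) (x : V → ℝ) : ℝ≥0∞ :=
  ∏ v ∈ Finset.univ \ S, (P.kernel v x : ℝ≥0∞)

/-- The joint density `∏ v, P(v | pa(v))`. -/
def density {V : Type*} [Fintype V] [DecidableEq V] {G : DAG V} (P : CausalModel G)
    (x : V → ℝ) : ℝ≥0∞ :=
  P.doDensity ∅ x

/-- The joint distribution of all variables. -/
def law {V : Type*} [Fintype V] [DecidableEq V] {G : DAG V} (P : CausalModel G) :
    Measure (V → ℝ) :=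
  (Measure.pi P.ref).withDensity P.density

/-- The density of the variables in `T`. -/
def marg {V : Type*} [Fintype V] [DecidableEq V] {G : DAG V} (P : CausalModel G)
    (T : Finset V) (x : V → ℝ) : ℝ≥0∞ :=
  lmarginal P.ref (Finset.univ \ T) P.density x

/-- The conditional density `P(S | T)`. -/
def cond {V : Type*} [Fintype V] [DecidableEq V] {G : DAG V} (P : CausalModel G)
    (S T : Finset V) (x : V → ℝ) : ℝ≥0∞ :=
  P.marg (S ∪ T) x / P.marg T x

/-- The conditional expectation `E[v | T]`. -/
def mean {V : Type*} [Fintype V] [DecidableEq V] {G : DAG V} (P : CausalModel G)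
    (v : V) (T : Finset V) (x : V → ℝ) : ℝ :=
  condMean P.ref Finset.univ P.density v T x

/-- Conditional independence in `P`. -/
def CondIndep {V : Type*} [Fintype V] [DecidableEq V] {G : DAG V} (P : CausalModel G)
    (X Y W : Finset V) : Prop :=
  DensityCondIndep P.ref Finset.univ P.density X Y W

/-- The observed distribution has a strictly positive density. -/
def Positive {V : Type*} [Fintype V] [DecidableEq V] {G : DAG V} (P : CausalModel G)
    (obs : Finset V) : Prop :=
  ∀ᵐ x ∂Measure.pi P.ref, 0 < P.marg obs x

/-- The reweighted observed density `P(V) / P(S | B)`, a density in the observed coordinates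
outside `S` for each value of `S`. -/
def verma {V : Type*} [Fintype V] [DecidableEq V] {G : DAG V} (P : CausalModel G)
    (obs S B : Finset V) (x : V → ℝ) : ℝ≥0∞ :=
  P.marg obs x / P.cond S B x

/-- The constraint `X ⫫ Y | W` in `P(V) / P(S | B)`, for each value of `S`. -/
def VermaCondIndep {V : Type*} [Fintype V] [DecidableEq V] {G : DAG V} (P : CausalModel G)
    (obs S B X Y W : Finset V) : Prop :=
  DensityCondIndep P.ref (obs \ S) (P.verma obs S B) X Y W

end CausalModel

/-- The edges of `G` are such that `P(V ∖ S | do(s)) = P(V) / P(S | B)` at `S = s`: this holds in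
every causal model of `G` (with a positive observed density, so that the right side is
defined). -/
def DAG.SupportsGFormula {V : Type*} [Fintype V] [DecidableEq V] (G : DAG V)
    (obs S B : Finset V) : Prop :=
  ∀ Q : CausalModel G, Q.Positive obs →
    ∀ᵐ x ∂Measure.pi Q.ref,
      lmarginal Q.ref (Finset.univ \ obs) (Q.doDensity S) x = Q.verma obs S B x

namespace CausalModel

/-- Ordinary faithfulness of the observed distribution: every conditional independence is a
d-separation. (The converse, the Markov property, holds for every causal model.) -/
def Faithful {V : Type*} [Fintype V] [DecidableEq V] {G : DAG V} (P : CausalModel G)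
    (obs : Finset V) : Prop :=
  ∀ X Y W : Finset V, X ⊆ obs → Y ⊆ obs → W ⊆ obs →
    Disjoint X Y → Disjoint X W → Disjoint Y W →
    P.CondIndep X Y W → G.DSep X Y W

/-- Verma faithfulness for the constraint `X ⫫ Y | W` in `P(V) / P(S | B)`: if it holds, then
`P(V) / P(S | B)` is `P(V ∖ S | do(s))` because of the edges of `G`, and `X` and `Y` are
d-separated given `W` in the graph under `do(s)`. There `S` is a set of fixed nodes, i.e.
constants, which block every walk through them: as edges into `S` are removed, this amounts to
adding `S` to the conditioning set. -/
def VermaFaithful {V : Type*} [Fintype V] [DecidableEq V] {G : DAG V} (P : CausalModel G)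
    (obs S B X Y W : Finset V) : Prop :=
  P.VermaCondIndep obs S B X Y W →
    G.SupportsGFormula obs S B ∧ (G.doGraph S).DSep X Y (W ∪ S)

/-! ### The causal effect and the identifying functionals -/

/-- `E[Y | do(A = a)]`. -/
def doMean {V : Type*} [Fintype V] [DecidableEq V] {G : DAG V} (P : CausalModel G)
    (A Y : V) (a : ℝ) : ℝ :=
  rmarg P.ref (Finset.univ \ {A}) (fun x => x Y * (P.doDensity {A} x).toReal)
    (Function.update 0 A a)

/-- `E[|Y| | do(A = a)] < ∞`. -/
def DoIntegrable {V : Type*} [Fintype V] [DecidableEq V] {G : DAG V} (P : CausalModel G)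
    (A Y : V) (a : ℝ) : Prop :=
  lmarginal P.ref (Finset.univ \ {A}) (fun x => ENNReal.ofReal |x Y| * P.doDensity {A} x)
    (Function.update 0 A a) < ∞

/-- The average causal effect `E[Y | do(A = 1)] - E[Y | do(A = 0)]`. -/
def ace {V : Type*} [Fintype V] [DecidableEq V] {G : DAG V} (P : CausalModel G)
    (A Y : V) : ℝ :=
  P.doMean A Y 1 - P.doMean A Y 0

/-- The backdoor formula
`∑_l P(l) (E[Y | A = 1, l] - E[Y | A = 0, l])`. -/
def backdoor {V : Type*} [Fintype V] [DecidableEq V] {G : DAG V} (P : CausalModel G)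
    (A Y : V) (L : Finset V) : ℝ :=
  rmarg P.ref L (fun x => (P.marg L x).toReal *
    (P.mean Y (insert A L) (Function.update x A 1) -
      P.mean Y (insert A L) (Function.update x A 0))) 0

/-- The conditional frontdoor formula
`∑_{m,l} (∑_{a'} P(a', l) E[Y | a', m, l]) (P(m | A = 1, l) - P(m | A = 0, l))`,
where `a'` ranges over `{0, 1}`. -/
def frontdoor {V : Type*} [Fintype V] [DecidableEq V] {G : DAG V} (P : CausalModel G)
    (A : V) (M : Finset V) (Y : V) (L : Finset V) : ℝ :=
  rmarg P.ref (M ∪ L) (fun x =>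
    (∑ a ∈ ({0, 1} : Finset ℝ), (P.marg (insert A L) (Function.update x A a)).toReal *
      P.mean Y (insert A (M ∪ L)) (Function.update x A a)) *
    ((P.cond M (insert A L) (Function.update x A 1)).toReal -
      (P.cond M (insert A L) (Function.update x A 0)).toReal)) 0

/-- `∑_l P(l) (E[T | Z = 1, l] - E[T | Z = 0, l])`. -/
def instrumentContrast {V : Type*} [Fintype V] [DecidableEq V] {G : DAG V} (P : CausalModel G)
    (Z T : V) (L : Finset V) : ℝ :=
  rmarg P.ref L (fun x => (P.marg L x).toReal *
    (P.mean T (insert Z L) (Function.update x Z 1) -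
      P.mean T (insert Z L) (Function.update x Z 0))) 0

/-- The instrumental variable (Wald-type) formula. -/
def wald {V : Type*} [Fintype V] [DecidableEq V] {G : DAG V} (P : CausalModel G)
    (Z A Y : V) (L : Finset V) : ℝ :=
  P.instrumentContrast Z Y L / P.instrumentContrast Z A L

open Classical in
/-- Homogeneity of the treatment effect: with `W` all the (observed and latent) variables that
are not descendants of `A`, the conditional effect
`E[Y | do(A = 1), W = w] - E[Y | do(A = 0), W = w]` is the same for almost all `w`. -/
def HomogeneousEffect {V : Type*} [Fintype V] [DecidableEq V] {G : DAG V} (P : CausalModel G)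
    (A Y : V) : Prop :=
  ∃ τ : ℝ, ∀ᵐ x ∂P.law,
    condMean P.ref (Finset.univ \ {A}) (P.doDensity {A}) Y
        (Finset.univ.filter fun v => ¬ G.Anc A v) (Function.update x A 1) -
      condMean P.ref (Finset.univ \ {A}) (P.doDensity {A}) Y
        (Finset.univ.filter fun v => ¬ G.Anc A v) (Function.update x A 0) = τ

end CausalModel

end Causal

end

/-!
All three formulas are identities between integrals of products of the conditional densities of the
model. Faithfulness and Verma faithfulness turn the parameters into statements about the graph, and
those are converted into factorizations of the truncated product `∏_{v ≠ A} P(v | pa(v))`, the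
density under `do(A = a)`. Two facts carry these conversions: the conditional densities of any set of
variables integrate to one, so that variables outside a parent-closed set can be integrated out
(`lmarginal_mul_kerProd`), and the global Markov property of the density under `do(A = a)`
(`exists_factorization`), whose combinatorial core is `DAG.exists_separation`.

*Backdoor formula.* If `Y` and `Z` are separated given `A` and `C`, then `C` is a backdoor set: an
open walk from a parent `p` of `A` to `Y` could be prolonged to `Z → A ← p ⋯ Y`, where the collider
`A` is conditioned on. Under `do(A = a)` the parents of `A` are therefore independent of `Y` given
`C`, and the factor `P(a | pa(A))` cancels in `E[Y | a, c]`.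

*Frontdoor formula.* The identity `P(V ∖ M | do(m)) = P(V) / P(M | A, Z, C)` in all models of the
graph excludes latent parents of `M`: such a parent would also cause `Y`, and in the model where it
is a fair coin of which an element of `M` and `Y` are noisy copies, the identity fails
(`DAG.SupportsGFormula.not_causes`). So `P(m | a, l)` is the product of the conditional densities of
the mediators. The separation of `Y` and `Z` under `do(m)` excludes directed paths from `A` to `Y`
around `M`, because of the edge `Z → A`; hence the mean of `Y` under `do(a, m)` does not depend
on `a`, and averaging it over `P(m | a, l)` gives the mean under `do(a)`.

*Wald formula.* A walk from `Z` to `Y` that avoids `A` and is open given `C` cannot reach `M`, which is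
separated from `Z` given `A` and `C`, nor reach `Y` without passing through `M`. So `Z` is
independent of `Y` given `C` under `do(A = 0)`, and a homogeneous effect `τ` gives
`E[Y | z, c] = E[Y | do(A = 0), c] + τ E[A | z, c]`, whose contrast in `z` is `τ` times that of `A`.

Means are handled by proving identities for the integrals of all nonnegative functions of `Y` and
subtracting negative from positive parts (`rmarg_eq_sub`, `rmarg_transport`).
-/

namespace Causal

/-! ### Integrals over some of the coordinates -/

theorem dependsOn_mul {V : Type*} {F G : (V → ℝ) → ℝ≥0∞} {T : Set V} (hF : DependsOn F T)
    (hG : DependsOn G T) : DependsOn (fun x => F x * G x) T := fun _ _ h =>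
  congrArg₂ (· * ·) (hF h) (hG h)

section Dependence

variable {V : Type*} [DecidableEq V]

theorem apply_updateFinset_of_dependsOn {β : Type*} {F : (V → ℝ) → β} {s : Finset V}
    (hF : DependsOn F (s : Set V)ᶜ) (x : V → ℝ) (y : s → ℝ) :
    F (Function.updateFinset x s y) = F x :=
  hF fun i hi => by
    have : i ∉ s := hi
    simp [Function.updateFinset, this]

theorem apply_update_of_dependsOn {β : Type*} {F : (V → ℝ) → β} {v : V} {T : Set V}
    (hF : DependsOn F T) (hv : v ∉ T) (x : V → ℝ) (a : ℝ) :
    F (Function.update x v a) = F x :=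
  hF fun i hi => Function.update_of_ne (fun h : i = v => hv (h ▸ hi)) _ _

end Dependence

section Marginals

variable {V : Type*} [DecidableEq V] {μ : V → Measure ℝ}

theorem dependsOn_lmarginal {β : Set V} {G : (V → ℝ) → ℝ≥0∞} (hG : DependsOn G β) (s : Finset V) :
    DependsOn (lmarginal μ s G) (β \ s) := by
  intro x y h
  unfold lmarginal
  refine lintegral_congr fun z => hG fun i hi => ?_
  by_cases his : i ∈ s
  · simp [Function.updateFinset, his]
  · simpa [Function.updateFinset, his] using h i ⟨hi, his⟩

theorem lmarginal_mul_left {s : Finset V} {F G : (V → ℝ) → ℝ≥0∞}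
    (hF : DependsOn F (s : Set V)ᶜ) (hG : Measurable G) (x : V → ℝ) :
    lmarginal μ s (fun x => F x * G x) x = F x * lmarginal μ s G x := by
  unfold lmarginal
  simp_rw [apply_updateFinset_of_dependsOn hF]
  exact lintegral_const_mul _ (hG.comp measurable_updateFinset)

theorem rmarg_mul_left {s : Finset V} {F : (V → ℝ) → ℝ}
    (hF : DependsOn F (s : Set V)ᶜ) (G : (V → ℝ) → ℝ) (x : V → ℝ) :
    rmarg μ s (fun x => F x * G x) x = F x * rmarg μ s G x := by
  unfold rmarg
  simp_rw [apply_updateFinset_of_dependsOn hF]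
  exact integral_const_mul _ _

theorem lmarginal_singleton_of_binary {v : V} (hv : μ v = Measure.dirac 0 + Measure.dirac 1)
    (F : (V → ℝ) → ℝ≥0∞) (x : V → ℝ) :
    lmarginal μ {v} F x = F (Function.update x v 0) + F (Function.update x v 1) := by
  simp only [lmarginal_singleton, hv, lintegral_add_measure, lintegral_dirac]

theorem ae_eq_zero_of_lmarginal_eq_zero {s : Finset V} {F : (V → ℝ) → ℝ≥0∞} (hF : Measurable F)
    {x : V → ℝ} (h : lmarginal μ s F x = 0) :
    ∀ᵐ y ∂Measure.pi (fun i : s => μ i), F (Function.updateFinset x s y) = 0 :=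
  (lintegral_eq_zero_iff (hF.comp measurable_updateFinset)).1 h

theorem ae_lt_top_of_lmarginal_lt_top {s : Finset V} {F : (V → ℝ) → ℝ≥0∞} (hF : Measurable F)
    {x : V → ℝ} (h : lmarginal μ s F x < ∞) :
    ∀ᵐ y ∂Measure.pi (fun i : s => μ i), F (Function.updateFinset x s y) < ∞ :=
  ae_lt_top (hF.comp measurable_updateFinset) h.ne

/-- The mean of coordinate `v` under the density `g` is the mean of its positive part minus that
of its negative part. -/
theorem rmarg_eq_sub {s : Finset V} {v : V} {g : (V → ℝ) → ℝ≥0∞} (hg : Measurable g)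
    (hgfin : ∀ x, g x ≠ ∞) {x : V → ℝ}
    (hfin : lmarginal μ s (fun x => ENNReal.ofReal |x v| * g x) x < ∞) :
    rmarg μ s (fun x => x v * (g x).toReal) x =
      (lmarginal μ s (fun x => ENNReal.ofReal (x v) * g x) x).toReal -
        (lmarginal μ s (fun x => ENNReal.ofReal (-x v) * g x) x).toReal := by
  have hm : Measurable (fun x : V → ℝ => x v * (g x).toReal) :=
    (measurable_pi_apply v).mul hg.ennreal_toReal
  have key : ∀ (a : ℝ) (b : ℝ≥0∞), b ≠ ∞ →
      ENNReal.ofReal (a * b.toReal) = ENNReal.ofReal a * b := by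
    intro a b hb
    rw [ENNReal.ofReal_mul' ENNReal.toReal_nonneg, ENNReal.ofReal_toReal hb]
  unfold rmarg lmarginal
  rw [integral_eq_lintegral_pos_part_sub_lintegral_neg_part]
  · simp_rw [← neg_mul, key _ _ (hgfin _)]
  · refine ⟨(hm.comp measurable_updateFinset).aestronglyMeasurable, ?_⟩
    refine lt_of_le_of_lt (le_of_eq ?_) hfin
    refine lintegral_congr fun y => ?_
    change _ = ENNReal.ofReal |_| * _
    rw [← key _ _ (hgfin _), Real.enorm_eq_ofReal_abs, abs_mul, abs_of_nonneg ENNReal.toReal_nonneg]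

/-- A proportionality between the integrals of all nonnegative functions of coordinate `v` under
two densities carries over to the means of coordinate `v`. -/
theorem rmarg_transport {s t : Finset V} {v : V} {g h : (V → ℝ) → ℝ≥0∞}
    (hg : Measurable g) (hh : Measurable h) (hgfin : ∀ x, g x ≠ ∞) (hhfin : ∀ x, h x ≠ ∞)
    {x x' : V → ℝ} {a b : ℝ≥0∞}
    (hfg : lmarginal μ s (fun x => ENNReal.ofReal |x v| * g x) x < ∞)
    (hfh : lmarginal μ t (fun x => ENNReal.ofReal |x v| * h x) x' < ∞)
    (H : ∀ φ : ℝ → ℝ≥0∞, Measurable φ →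
      a * lmarginal μ s (fun x => φ (x v) * g x) x =
        b * lmarginal μ t (fun x => φ (x v) * h x) x') :
    a.toReal * rmarg μ s (fun x => x v * (g x).toReal) x =
      b.toReal * rmarg μ t (fun x => x v * (h x).toReal) x' := by
  rw [rmarg_eq_sub hg hgfin hfg, rmarg_eq_sub hh hhfin hfh, mul_sub, mul_sub]
  simp_rw [← ENNReal.toReal_mul]
  rw [H _ ENNReal.measurable_ofReal, H (fun t => ENNReal.ofReal (-t))
    (ENNReal.measurable_ofReal.comp measurable_neg)]

variable [∀ v, SigmaFinite (μ v)]

/-- The integral over the coordinates in `s ∪ t` of a product factors if neither factor depends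
on the coordinates integrated in the other one. -/
theorem lmarginal_union_mul {s t : Finset V} (hst : Disjoint s t) {F G : (V → ℝ) → ℝ≥0∞}
    (hFm : Measurable F) (hGm : Measurable G)
    (hF : DependsOn F (t : Set V)ᶜ) (hG : DependsOn G (s : Set V)ᶜ) (x : V → ℝ) :
    lmarginal μ (s ∪ t) (fun x => F x * G x) x = lmarginal μ s F x * lmarginal μ t G x := by
  rw [lmarginal_union μ (fun x => F x * G x) (hFm.mul hGm) hst]
  have h1 : lmarginal μ t (fun x => F x * G x) = fun x => lmarginal μ t G x * F x := by
    funext x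
    rw [lmarginal_mul_left hF hGm, mul_comm]
  rw [h1, lmarginal_mul_left _ hFm, mul_comm]
  exact (dependsOn_lmarginal hG t).mono Set.sdiff_subset

/-! ### Almost everywhere statements on products -/

/-- An almost everywhere statement survives integrating over some coordinates: a null set has
null sections almost everywhere. -/
theorem ae_ae_updateFinset [Fintype V] {p : (V → ℝ) → Prop} (h : ∀ᵐ x ∂Measure.pi μ, p x)
    (s : Finset V) :
    ∀ᵐ x ∂Measure.pi μ, ∀ᵐ y ∂Measure.pi (fun i : s => μ i), p (Function.updateFinset x s y) := by
  obtain ⟨N, hpN, hN, hN0⟩ := exists_measurable_superset_of_null (ae_iff.1 h)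
  set I : (V → ℝ) → ℝ≥0∞ := N.indicator 1 with hI
  have hIm : Measurable I := measurable_one.indicator hN
  have hsu : sᶜ ∪ s = Finset.univ := by rw [Finset.union_comm, Finset.union_compl]
  have hzero : ∀ x, lmarginal μ sᶜ (lmarginal μ s I) x = 0 := by
    intro x
    rw [← lmarginal_union μ I hIm disjoint_compl_left, hsu,
      ← lintegral_eq_lmarginal_univ, lintegral_indicator_one hN, hN0]
  have hG : ∫⁻ x, lmarginal μ s I x ∂Measure.pi μ = 0 := by
    rcases isEmpty_or_nonempty (V → ℝ) with h | ⟨⟨x⟩⟩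
    · simp
    rw [lintegral_eq_lmarginal_univ x, ← hsu,
      lmarginal_union' μ _ (hIm.lmarginal μ) disjoint_compl_left]
    have : lmarginal μ sᶜ (lmarginal μ s I) = fun _ => 0 := funext hzero
    rw [this]
    simp [lmarginal]
  rw [lintegral_eq_zero_iff (hIm.lmarginal μ)] at hG
  filter_upwards [hG] with x hx
  filter_upwards [ae_eq_zero_of_lmarginal_eq_zero hIm hx] with y hy
  by_contra hcon
  have : Function.updateFinset x s y ∈ N := hpN hcon
  simp [hI, this] at hy

/-- An almost everywhere statement holds at almost all values of the coordinates in `s`, the other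
coordinates on which it depends being fixed at atoms. -/
theorem ae_updateFinset [Fintype V] (hμ : ∀ v, μ v ≠ 0) {p : (V → ℝ) → Prop}
    (h : ∀ᵐ x ∂Measure.pi μ, p x) (s T : Finset V) (hp : DependsOn p (T : Set V)) (x : V → ℝ)
    (hx : ∀ i ∈ T, i ∉ s → μ i {x i} ≠ 0) :
    ∀ᵐ y ∂Measure.pi (fun i : s => μ i), p (Function.updateFinset x s y) := by
  obtain ⟨N, hpN, hN, hN0⟩ := exists_measurable_superset_of_null (ae_iff.1 h)
  set I : (V → ℝ) → ℝ≥0∞ := N.indicator 1 with hI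
  have hIm : Measurable I := measurable_one.indicator hN
  have hzero : lmarginal μ s (lmarginal μ sᶜ I) x = 0 := by
    rw [← lmarginal_union μ I hIm disjoint_compl_right, Finset.union_compl,
      ← lintegral_eq_lmarginal_univ, lintegral_indicator_one hN, hN0]
  filter_upwards [ae_eq_zero_of_lmarginal_eq_zero (hIm.lmarginal μ) hzero] with y hy
  have hy' := ae_eq_zero_of_lmarginal_eq_zero hIm hy
  set B : Set ((sᶜ : Finset V) → ℝ) :=
    Set.univ.pi fun i => if (i : V) ∈ T then {x i} else Set.univ with hB
  have hBpos : Measure.pi (fun i : (sᶜ : Finset V) => μ i) B ≠ 0 := by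
    rw [hB, Measure.pi_pi, Finset.prod_ne_zero_iff]
    intro i _
    split_ifs with hi
    · exact hx i hi (Finset.mem_compl.1 i.2)
    · simpa using hμ i
  obtain ⟨z, hzB, hz⟩ : ∃ z ∈ B, I (Function.updateFinset (Function.updateFinset x s y) sᶜ z) = 0 := by
    by_contra! hcon
    exact hBpos (measure_mono_null (fun z hz => hcon z hz) (ae_iff.1 hy'))
  have hpz : p (Function.updateFinset (Function.updateFinset x s y) sᶜ z) := by
    by_contra hcon
    have : Function.updateFinset (Function.updateFinset x s y) sᶜ z ∈ N := hpN hcon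
    simp [hI, this] at hz
  refine (hp fun i hi => ?_).mp hpz
  by_cases his : i ∈ s
  · simp [Function.updateFinset, his]
  · have := hzB ⟨i, by simpa using his⟩ trivial
    have hi' : i ∈ T := hi
    simp only [hi', if_true, Set.mem_singleton_iff] at this
    simp [Function.updateFinset, his, this]

/-! ### Integrals of real functions over some of the coordinates -/

/-- Fubini's theorem for `rmarg`. -/
theorem integrable_rmarg_and_rmarg_union {s t : Finset V} (hst : Disjoint s t) {F : (V → ℝ) → ℝ}
    (hF : Measurable F) {x : V → ℝ} (hfin : lmarginal μ (s ∪ t) (fun x => ‖F x‖ₑ) x < ∞) :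
    Integrable (fun y : s → ℝ => rmarg μ t F (Function.updateFinset x s y))
        (Measure.pi fun i : s => μ i) ∧
      rmarg μ (s ∪ t) F x = rmarg μ s (rmarg μ t F) x := by
  let e := MeasurableEquiv.piFinsetUnion (fun _ : V => ℝ) hst
  have hmp := measurePreserving_piFinsetUnion hst μ
  have hint : Integrable (fun y : ((s ∪ t : Finset V) → ℝ) => F (Function.updateFinset x (s ∪ t) y))
      (Measure.pi fun i : (s ∪ t : Finset V) => μ i) :=
    ⟨(hF.comp measurable_updateFinset).aestronglyMeasurable, hfin⟩
  have hint' : Integrable (fun y : (s → ℝ) × (t → ℝ) => F (Function.updateFinset x (s ∪ t) (e y)))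
      ((Measure.pi fun i : s => μ i).prod (Measure.pi fun i : t => μ i)) :=
    (hmp.integrable_comp_emb e.measurableEmbedding).2 hint
  have hrw : ∀ (y : s → ℝ) (z : t → ℝ), F (Function.updateFinset x (s ∪ t) (e (y, z))) =
      F (Function.updateFinset (Function.updateFinset x s y) t z) := by
    intro y z
    rw [Function.updateFinset_updateFinset hst]
    rfl
  constructor
  · have := hint'.integral_prod_left
    simp_rw [hrw] at this
    exact this
  · unfold rmarg
    rw [← hmp.integral_comp' (f := e), integral_prod _ hint']
    simp_rw [hrw]

end Marginals

/-! ### Products of conditional densities -/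

/-- The number of ancestors is a topological ordering of a finite directed acyclic graph. -/
theorem DAG.exists_topological_order {V : Type*} [Finite V] (G : DAG V) :
    ∃ t : V → ℕ, ∀ u v, G.Adj u v → t u < t v := by
  refine ⟨fun v => {u | G.Anc u v}.ncard, fun u v huv => ?_⟩
  refine Set.ncard_lt_ncard ⟨fun w hw => hw.tail huv, fun h => ?_⟩ (Set.toFinite _)
  have : G.Anc v u := h (Relation.ReflTransGen.refl : G.Anc v v)
  exact G.acyclic v (Relation.TransGen.tail' this huv)

namespace CausalModel

variable {V : Type*} [Fintype V] [DecidableEq V] {G : DAG V} (P : CausalModel G)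

/-- The product of the conditional densities of the variables in `s`. -/
noncomputable def kerProd (s : Finset V) (x : V → ℝ) : ℝ≥0∞ :=
  ∏ v ∈ s, (P.kernel v x : ℝ≥0∞)

theorem measurable_kerProd (s : Finset V) : Measurable (P.kerProd s) :=
  Finset.measurable_prod _ fun v _ => (P.measurable_kernel v).coe_nnreal_ennreal

theorem kerProd_ne_top (s : Finset V) (x : V → ℝ) : P.kerProd s x ≠ ∞ :=
  ENNReal.prod_ne_top fun _ _ => ENNReal.coe_ne_top

theorem dependsOn_kernel (v : V) :
    DependsOn (fun x => (P.kernel v x : ℝ≥0∞)) {u | u = v ∨ G.Adj u v} := by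
  intro x y h
  exact congrArg _ <| P.kernel_local v x y (h v (Or.inl rfl)) fun u hu => h u (Or.inr hu)

theorem dependsOn_kerProd (s : Finset V) :
    DependsOn (P.kerProd s) {u | ∃ v ∈ s, u = v ∨ G.Adj u v} := by
  intro x y h
  exact Finset.prod_congr rfl fun v hv => P.dependsOn_kernel v fun u hu => h u ⟨v, hv, hu⟩

theorem kerProd_union {s t : Finset V} (hst : Disjoint s t) (x : V → ℝ) :
    P.kerProd (s ∪ t) x = P.kerProd s x * P.kerProd t x :=
  Finset.prod_union hst

theorem kerProd_insert {v : V} {s : Finset V} (hv : v ∉ s) (x : V → ℝ) :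
    P.kerProd (insert v s) x = P.kernel v x * P.kerProd s x :=
  Finset.prod_insert hv

theorem density_eq_kerProd : P.density = P.kerProd Finset.univ := by
  funext x
  simp [density, doDensity, kerProd]

theorem ref_ne_zero (v : V) : P.ref v ≠ 0 := by
  intro h
  have := P.kernel_norm v 0
  simp [h] at this

/-- The conditional densities of any set of variables integrate to `1`: the variables can be
integrated out against a topological ordering. -/
theorem lmarginal_kerProd_self (s : Finset V) (x : V → ℝ) :
    lmarginal P.ref s (P.kerProd s) x = 1 := by
  obtain ⟨t, ht⟩ := G.exists_topological_order
  induction s using Finset.induction_on_max_value t generalizing x with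
  | empty => simp [kerProd]
  | insert v s hv hmax ih =>
    rw [lmarginal_insert' _ (P.measurable_kerProd _) hv]
    rw [← ih x]
    congr 1
    funext x
    have hdep : DependsOn (P.kerProd s) ({v} : Set V)ᶜ := by
      refine (P.dependsOn_kerProd s).mono ?_
      rintro u ⟨w, hw, rfl | huw⟩ rfl
      · exact hv hw
      · exact absurd (ht _ _ huw) (hmax w hw).not_gt
    simp_rw [P.kerProd_insert hv, apply_update_of_dependsOn hdep (by simp : v ∉ ({v} : Set V)ᶜ)]
    rw [lintegral_mul_const' _ _ (P.kerProd_ne_top s x), P.kernel_norm, one_mul]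

/-- Variables outside a parent-closed set `D` can be dropped from an integral whose integrand
does not involve them otherwise. -/
theorem lmarginal_mul_kerProd {T D N : Finset V} (hTD : T ⊆ D) (hDN : D ⊆ N)
    (hD : ∀ v ∈ D, ∀ u ∈ N, G.Adj u v → u ∈ D) {ψ : (V → ℝ) → ℝ≥0∞} (hψm : Measurable ψ)
    (hψ : DependsOn ψ ((N \ D : Finset V) : Set V)ᶜ) (x : V → ℝ) :
    lmarginal P.ref (N \ T) (fun x => ψ x * P.kerProd N x) x =
      lmarginal P.ref (D \ T) (fun x => ψ x * P.kerProd D x) x := by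
  have hset : N \ T = (D \ T) ∪ (N \ D) := by
    ext v
    have := @hTD v
    have := @hDN v
    simp only [Finset.mem_sdiff, Finset.mem_union]
    tauto
  have hN : N = D ∪ (N \ D) := by rw [Finset.union_sdiff_of_subset hDN]
  have hdisj : Disjoint (D \ T) (N \ D) :=
    Finset.disjoint_sdiff.mono_left Finset.sdiff_subset
  have hdep : DependsOn (fun x => ψ x * P.kerProd D x) ((N \ D : Finset V) : Set V)ᶜ := by
    intro y z h
    have h1 := hψ h
    have h2 : P.kerProd D y = P.kerProd D z := by
      refine P.dependsOn_kerProd D fun u hu => h u ?_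
      obtain ⟨v, hv, rfl | huv⟩ := hu
      · simp [hv]
      · have := hD v hv u
        simp
        tauto
    simp only [h1, h2]
  rw [hset, lmarginal_union P.ref (fun x => ψ x * P.kerProd N x)
    (hψm.mul (P.measurable_kerProd N)) hdisj]
  congr 1
  funext y
  have : (fun x => ψ x * P.kerProd N x) =
      fun x => (ψ x * P.kerProd D x) * P.kerProd (N \ D) x := by
    funext z
    rw [mul_assoc, ← P.kerProd_union Finset.disjoint_sdiff, ← hN]
  rw [this, lmarginal_mul_left hdep (P.measurable_kerProd _), P.lmarginal_kerProd_self, mul_one]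

end CausalModel

/-! ### Open walks and separation -/

namespace DAG

variable {V : Type*} {G : DAG V} {W : Finset V}

theorem not_adj_of_adj (G : DAG V) {u v : V} (h : G.Adj u v) : ¬ G.Adj v u := fun h' =>
  G.acyclic u ((Relation.TransGen.single h).tail h')

/-- `G.Trail W z a b`: there is a walk from `z` whose last two vertices are `a` and `b` and which is
open given `W`. Keeping the last two vertices is what is needed to extend the walk. -/
inductive Trail (G : DAG V) (W : Finset V) (z : V) : V → V → Prop
  | edge {b : V} : G.Adj z b ∨ G.Adj b z → Trail G W z z b
  | step {a b c : V} : Trail G W z a b → G.Adj b c ∨ G.Adj c b →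
      (G.Adj a b ∧ G.Adj c b → ∃ w ∈ W, G.Anc b w) → (¬ (G.Adj a b ∧ G.Adj c b) → b ∉ W) →
      Trail G W z b c

theorem Trail.adj {z a b : V} (h : G.Trail W z a b) : G.Adj a b ∨ G.Adj b a := by
  cases h <;> assumption

theorem Trail.exists_openWalk {z a b : V} (h : G.Trail W z a b) :
    ∃ l : List V, G.OpenWalk W (l ++ [a, b]) ∧ (l ++ [a, b]).head? = some z := by
  induction h with
  | edge h =>
    refine ⟨[], ⟨by simpa using h, fun a b c habc => ?_⟩, rfl⟩
    have := habc.length_le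
    simp at this
  | @step a b c h hbc hcol hnon ih =>
    obtain ⟨l, ⟨hchain, hopen⟩, hhead⟩ := ih
    refine ⟨l ++ [a], ⟨?_, fun a' b' c' h' => ?_⟩, ?_⟩
    · have : l ++ [a] ++ [b, c] = (l ++ [a, b]) ++ [c] := by simp
      rw [this, List.isChain_append]
      refine ⟨hchain, by simp, ?_⟩
      simpa using hbc
    · have heq : l ++ [a] ++ [b, c] = (l ++ [a, b]) ++ [c] := by simp
      rw [heq, List.infix_concat_iff] at h'
      rcases h' with h' | h'
      · obtain ⟨t, ht⟩ := h'
        have heq' : (l ++ [a, b]) ++ [c] = l ++ [a, b, c] := by simp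
        rw [heq'] at ht
        have := (List.append_inj' ht rfl).2
        simp only [List.cons.injEq, and_true] at this
        obtain ⟨rfl, rfl, rfl⟩ := this
        exact ⟨hcol, hnon⟩
      · exact hopen a' b' c' h'
    · have heq : l ++ [a] ++ [b, c] = (l ++ [a, b]) ++ [c] := by simp
      rw [heq, List.head?_append, hhead]
      rfl

theorem OpenWalk.reverse {l : List V} (h : G.OpenWalk W l) : G.OpenWalk W l.reverse := by
  refine ⟨?_, fun a b c habc => ?_⟩
  · rw [List.isChain_reverse]
    exact h.1.imp fun a b hab => hab.symm
  · have := h.2 c b a (by simpa using List.reverse_infix.2 habc)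
    simpa only [and_comm] using this

theorem DSep.not_trail {X Y : Finset V} (h : G.DSep X Y W) {x a y : V} (hx : x ∈ X) (hy : y ∈ Y) :
    ¬ G.Trail W x a y := fun ht => by
  obtain ⟨l, hl, hhead⟩ := ht.exists_openWalk
  exact h x hx y hy _ hhead (by simp) hl

theorem DSep.symm {X Y : Finset V} (h : G.DSep X Y W) : G.DSep Y X W :=
  fun y hy x hx l hhead hlast hl =>
    h x hx y hy l.reverse (by simpa using hlast) (by simpa using hhead) hl.reverse

/-- A directed path from `c` to `x` without a descendant in `W`, traversed backwards from `x`. -/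
theorem trail_of_anc {c x : V} (h : G.Anc c x) (hW : ∀ w ∈ W, ¬ G.Anc c w) :
    c = x ∨ ∃ a, G.Trail W x a c ∧ G.Adj c a := by
  induction h using Relation.ReflTransGen.head_induction_on with
  | refl => exact Or.inl rfl
  | @head c d hcd hdx ih =>
    right
    have hW' : ∀ w ∈ W, ¬ G.Anc d w := fun w hw hdw => hW w hw (hdw.head hcd)
    rcases ih hW' with rfl | ⟨a, ha, hda⟩
    · exact ⟨d, .edge (Or.inr hcd), hcd⟩
    · exact ⟨d, .step ha (Or.inr hcd) (fun h => absurd hda (G.not_adj_of_adj h.1))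
        fun _ hd => hW' d hd .refl, hcd⟩

/-- A walk arriving at `c` can be continued along a directed path without a descendant in `W`. -/
theorem Trail.exists_of_anc {x v c y : V} (h : G.Trail W x v c) (hvc : G.Adj v c) (hcy : G.Anc c y)
    (hW : ∀ w ∈ W, ¬ G.Anc c w) : ∃ a, G.Trail W x a y := by
  induction hcy using Relation.ReflTransGen.head_induction_on generalizing v with
  | refl => exact ⟨v, h⟩
  | @head c d hcd hdy ih =>
    exact ih (h.step (Or.inl hcd) (fun h => absurd h.2 (G.not_adj_of_adj hcd))
      fun _ hc => hW c hc .refl) hcd fun w hw hdw => hW w hw (hdw.head hcd)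

/-- The combinatorial core of the global Markov property. If no open walk leads from `X` to `y`
given `W`, then the ancestral set `D` of `X`, `y` and `W` has a part `R` disjoint from `W`,
containing `X` and not `y`, such that no vertex of `D` together with its parents meets both `R` and
the complement of `R ∪ W`. The set `R` consists of the vertices reachable by open walks. -/
theorem exists_separation [Fintype V] (X : Finset V) (y : V) (hXW : Disjoint X W)
    (hyX : y ∉ X) (hsep : ∀ x ∈ X, ∀ a, ¬ G.Trail W x a y) :
    ∃ D R : Finset V, X ⊆ R ∧ W ⊆ D ∧ y ∈ D ∧ R ⊆ D ∧ Disjoint R W ∧ y ∉ R ∧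
      (∀ v ∈ D, ∀ u, G.Adj u v → u ∈ D) ∧
      ∀ c ∈ D, ∀ v ∈ R, (v = c ∨ G.Adj v c) → ∀ u, (u = c ∨ G.Adj u c) → u ∈ R ∨ u ∈ W := by
  classical
  let D : Finset V := {v | ∃ d, (d ∈ X ∨ d = y ∨ d ∈ W) ∧ G.Anc v d}
  let Reach : V → Prop := fun v => v ∈ X ∨ ∃ x ∈ X, ∃ a, G.Trail W x a v
  let R : Finset V := {v | v ∈ D ∧ v ∉ W ∧ Reach v}
  have memD : ∀ v, v ∈ D ↔ ∃ d, (d ∈ X ∨ d = y ∨ d ∈ W) ∧ G.Anc v d := fun v => by simp [D]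
  have memR : ∀ v, v ∈ R ↔ v ∈ D ∧ v ∉ W ∧ Reach v := fun v => by simp [R]
  have hDpar : ∀ v ∈ D, ∀ u, G.Adj u v → u ∈ D := fun v hv u huv => by
    obtain ⟨d, hd, hvd⟩ := (memD v).1 hv
    exact (memD u).2 ⟨d, hd, hvd.head huv⟩
  -- a vertex of `R` passes on along outgoing edges
  have down : ∀ v ∈ R, ∀ c, G.Adj v c → ∃ x ∈ X, G.Trail W x v c := by
    intro v hv c hvc
    obtain ⟨-, hvW, hvX | ⟨x, hx, a, ha⟩⟩ := (memR v).1 hv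
    · exact ⟨v, hvX, .edge (Or.inl hvc)⟩
    · exact ⟨x, hx, ha.step (Or.inl hvc) (fun h => absurd h.2 (G.not_adj_of_adj hvc)) fun _ => hvW⟩
  -- a walk that enters `c ∈ D` forwards leads to the parents of `c`: either `c` is an ancestor
  -- of `W`, an open collider, or the walk restarts at a descendant of `c` in `X`
  have up : ∀ x ∈ X, ∀ v c w, G.Trail W x v c → G.Adj v c → c ∈ D → G.Adj w c → Reach w := by
    intro x hx v c w htr hvc hcD hwc
    by_cases hcW : ∃ w ∈ W, G.Anc c w
    · obtain ⟨w', hw', hcw'⟩ := hcW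
      exact Or.inr ⟨x, hx, c, htr.step (Or.inr hwc) (fun _ => ⟨w', hw', hcw'⟩)
        fun h => absurd ⟨hvc, hwc⟩ h⟩
    push Not at hcW
    obtain ⟨d, hd | rfl | hd, hcd⟩ := (memD c).1 hcD
    · rcases trail_of_anc hcd hcW with rfl | ⟨a, ha, hca⟩
      · exact Or.inr ⟨c, hd, c, .edge (Or.inr hwc)⟩
      · exact Or.inr ⟨d, hd, c, ha.step (Or.inr hwc)
          (fun h => absurd hca (G.not_adj_of_adj h.1)) fun _ hc => hcW c hc .refl⟩
    · obtain ⟨a, ha⟩ := htr.exists_of_anc hvc hcd hcW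
      exact absurd ha (hsep x hx a)
    · exact absurd hcd (hcW d hd)
  refine ⟨D, R, fun x hx => ?_, fun w hw => ?_, ?_, fun v hv => ((memR v).1 hv).1, ?_, ?_, hDpar, ?_⟩
  · exact (memR x).2 ⟨(memD x).2 ⟨x, Or.inl hx, .refl⟩, Finset.disjoint_left.1 hXW hx, Or.inl hx⟩
  · exact (memD w).2 ⟨w, Or.inr (Or.inr hw), .refl⟩
  · exact (memD y).2 ⟨y, Or.inr (Or.inl rfl), .refl⟩
  · exact Finset.disjoint_left.2 fun v hv => ((memR v).1 hv).2.1
  · intro hy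
    obtain ⟨-, -, h | ⟨x, hx, a, ha⟩⟩ := (memR y).1 hy
    · exact hyX h
    · exact hsep x hx a ha
  · intro c hc v hv hvc u huc
    by_cases huW : u ∈ W
    · exact Or.inr huW
    left
    have huD : u ∈ D := by
      rcases huc with rfl | huc
      · exact hc
      · exact hDpar c hc u huc
    refine (memR u).2 ⟨huD, huW, ?_⟩
    rcases hvc with rfl | hvc <;> rcases huc with rfl | huc
    · exact ((memR _).1 hv).2.2
    · obtain ⟨-, hvW, hvX | ⟨x, hx, a, ha⟩⟩ := (memR v).1 hv
      · exact Or.inr ⟨v, hvX, v, .edge (Or.inr huc)⟩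
      · by_cases hav : G.Adj a v
        · exact up x hx a v u ha hav hc huc
        · exact Or.inr ⟨x, hx, v, ha.step (Or.inr huc) (fun h => absurd h.1 hav) fun _ => hvW⟩
    · obtain ⟨x, hx, ha⟩ := down v hv u hvc
      exact Or.inr ⟨x, hx, v, ha⟩
    · obtain ⟨x, hx, ha⟩ := down v hv c hvc
      exact up x hx v c u ha hvc hc huc

/-- The graph with the edges at the vertex `A` removed, so that `A` is isolated. -/
def isolate (G : DAG V) (A : V) : DAG V where
  Adj u v := G.Adj u v ∧ u ≠ A ∧ v ≠ A
  acyclic v h := G.acyclic v (Relation.TransGen.mono (fun _ _ hab => hab.1) v v h)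

theorem anc_of_anc_isolate {A u v : V} (h : (G.isolate A).Anc u v) : G.Anc u v :=
  Relation.ReflTransGen.mono (fun _ _ hab => hab.1) _ _ h

end DAG

/-! ### The global Markov property under an intervention -/

namespace CausalModel

variable {V : Type*} [Fintype V] [DecidableEq V] {G : DAG V} (P : CausalModel G)

/-- The global Markov property of the density under `do(A = a)`. If no walk of the graph without
`A` from `X` to `y` is open given `C`, then integrals over the coordinates outside `C` and `A`
factor into a functional of the part depending on `X` and one of the part depending on `y`. -/
theorem exists_factorization {A : V} {X C : Finset V} {y : V} (hAX : A ∉ X) (hyA : y ≠ A)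
    (hAC : A ∉ C) (hXC : Disjoint X C) (hyX : y ∉ X)
    (hsep : ∀ x ∈ X, ∀ a, ¬ (G.isolate A).Trail C x a y) (x : V → ℝ) :
    ∃ a b : ((V → ℝ) → ℝ≥0∞) → ℝ≥0∞, ∀ ψ₁ ψ₂ : (V → ℝ) → ℝ≥0∞,
      Measurable ψ₁ → Measurable ψ₂ →
      DependsOn ψ₁ {v | v ∈ X ∨ v ∈ C ∨ v = A} → DependsOn ψ₂ {v | v = y ∨ v ∈ C ∨ v = A} →
      lmarginal P.ref ((Finset.univ \ {A}) \ C)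
        (fun x => ψ₁ x * ψ₂ x * P.kerProd (Finset.univ \ {A}) x) x = a ψ₁ * b ψ₂ := by
  classical
  obtain ⟨D₀, R₀, hXR, hCD, hyD, hRD, hRC, hyR, hpar, hscope⟩ :=
    DAG.exists_separation (G := G.isolate A) X y hXC hyX hsep
  -- `A` is isolated, and is dropped from both sets
  set D := D₀.erase A
  set R := R₀.erase A
  set Q := (D \ C) \ R with hQ
  set DR := D.filter fun c => ∃ v ∈ R, v = c ∨ G.Adj v c
  have hDc : D \ C = R ∪ Q := by
    rw [hQ, Finset.union_sdiff_of_subset]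
    intro v hv
    have hv' := Finset.mem_erase.1 hv
    exact Finset.mem_sdiff.2 ⟨Finset.mem_erase.2 ⟨hv'.1, hRD hv'.2⟩,
      Finset.disjoint_left.1 hRC hv'.2⟩
  have hRQ : Disjoint R Q := Finset.disjoint_sdiff
  have hFdep : DependsOn (P.kerProd DR) (Q : Set V)ᶜ := by
    refine (P.dependsOn_kerProd DR).mono ?_
    rintro u ⟨c, hc, huc⟩ huQ
    have huQ' := Finset.mem_sdiff.1 huQ
    have huD := Finset.mem_sdiff.1 huQ'.1
    have huA := (Finset.mem_erase.1 huD.1).1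
    obtain ⟨hcD, v, hv, hvc⟩ := Finset.mem_filter.1 hc
    have hcD' := Finset.mem_erase.1 hcD
    have hv' := Finset.mem_erase.1 hv
    rcases hscope c hcD'.2 v hv'.2 (hvc.imp_right fun h => ⟨h, hv'.1, hcD'.1⟩) u
      (huc.imp_right fun h => ⟨h, huA, hcD'.1⟩) with h | h
    · exact huQ'.2 (Finset.mem_erase.2 ⟨huA, h⟩)
    · exact huD.2 h
  have hHdep : DependsOn (P.kerProd (D \ DR)) (R : Set V)ᶜ := by
    refine (P.dependsOn_kerProd (D \ DR)).mono ?_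
    rintro u ⟨c, hc, huc⟩ huR
    have hc' := Finset.mem_sdiff.1 hc
    exact hc'.2 (Finset.mem_filter.2 ⟨hc'.1, u, huR, huc⟩)
  refine ⟨fun ψ₁ => lmarginal P.ref R (fun x => ψ₁ x * P.kerProd DR x) x,
    fun ψ₂ => lmarginal P.ref Q (fun x => ψ₂ x * P.kerProd (D \ DR) x) x, ?_⟩
  intro ψ₁ ψ₂ hm₁ hm₂ hψ₁ hψ₂
  have hXD : ∀ v ∈ X, v ∈ D := fun v hv =>
    Finset.mem_erase.2 ⟨fun h => hAX (h ▸ hv), hRD (hXR hv)⟩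
  have hCD' : ∀ v ∈ C, v ∈ D := fun v hv => Finset.mem_erase.2 ⟨fun h => hAC (h ▸ hv), hCD hv⟩
  have hyD' : y ∈ D := Finset.mem_erase.2 ⟨hyA, hyD⟩
  rw [P.lmarginal_mul_kerProd (T := C) (D := D) hCD' (fun v hv => by
    simpa using (Finset.mem_erase.1 hv).1) ?_ (ψ := fun x => ψ₁ x * ψ₂ x) (hm₁.mul hm₂), hDc]
  · have hsplit : (fun x => ψ₁ x * ψ₂ x * P.kerProd D x) =
        fun x => (ψ₁ x * P.kerProd DR x) * (ψ₂ x * P.kerProd (D \ DR) x) := by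
      funext z
      have : P.kerProd D z = P.kerProd DR z * P.kerProd (D \ DR) z := by
        rw [← P.kerProd_union Finset.disjoint_sdiff,
          Finset.union_sdiff_of_subset (Finset.filter_subset _ _)]
      rw [this]
      ring
    rw [hsplit]
    refine lmarginal_union_mul hRQ (hm₁.mul (P.measurable_kerProd _))
      (hm₂.mul (P.measurable_kerProd _)) ?_ ?_ x
    · intro z z' h
      refine congrArg₂ (· * ·) (hψ₁ fun i hi => h i ?_) (hFdep h)
      intro hiQ
      have hiQ' := Finset.mem_sdiff.1 hiQ
      have hiD := Finset.mem_sdiff.1 hiQ'.1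
      rcases hi with hi | hi | hi
      · exact hiQ'.2 (Finset.mem_erase.2 ⟨fun h => hAX (h ▸ hi), hXR hi⟩)
      · exact hiD.2 hi
      · exact (Finset.mem_erase.1 hiD.1).1 hi
    · intro z z' h
      refine congrArg₂ (· * ·) (hψ₂ fun i hi => h i ?_) (hHdep h)
      intro hiR
      have hiR' := Finset.mem_erase.1 hiR
      rcases hi with hi | hi | hi
      · exact hyR (hi ▸ hiR'.2)
      · exact Finset.disjoint_left.1 hRC hiR'.2 hi
      · exact hiR'.1 hi
  · intro z z' h
    have hmem : ∀ i, (i ∈ D ∨ i = A) → z i = z' i := fun i hi => h i fun hi' => by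
      have hi'' := Finset.mem_sdiff.1 hi'
      rcases hi with hi | hi
      · exact hi''.2 hi
      · simp [hi] at hi''
    refine congrArg₂ (· * ·) (hψ₁ fun i hi => hmem i ?_) (hψ₂ fun i hi => hmem i ?_)
    · rcases hi with hi | hi | hi
      exacts [Or.inl (hXD i hi), Or.inl (hCD' i hi), Or.inr hi]
    · rcases hi with rfl | hi | hi
      exacts [Or.inl hyD', Or.inl (hCD' i hi), Or.inr hi]
  · intro v hv u hu huv
    have hv' := Finset.mem_erase.1 hv
    have huA : u ≠ A := by simpa using hu
    exact Finset.mem_erase.2 ⟨huA, hpar v hv'.2 u ⟨huv, huA, hv'.1⟩⟩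

/-- The integrals over the variables outside `A` and `T` under `do(A = a)` are those of the
observational density, if `A` is not an ancestor of any variable in `T`. -/
theorem lmarginal_do_eq_marg {A : V} {T : Finset V} (hT : ∀ v ∈ T, ¬ G.Anc A v) (x : V → ℝ) :
    lmarginal P.ref ((Finset.univ \ {A}) \ T) (P.kerProd (Finset.univ \ {A})) x = P.marg T x := by
  classical
  let D : Finset V := {v | ¬ G.Anc A v}
  have hTD : T ⊆ D := fun v hv => by simpa [D] using hT v hv
  have hDA : D ⊆ Finset.univ \ {A} := fun v hv => by
    simp only [D, Finset.mem_filter_univ] at hv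
    simp only [Finset.mem_sdiff, Finset.mem_univ, Finset.mem_singleton, true_and]
    rintro rfl
    exact hv .refl
  have hpar : ∀ v ∈ D, ∀ u, G.Adj u v → u ∈ D := fun v hv u huv => by
    simp only [D, Finset.mem_filter_univ] at hv ⊢
    exact fun h => hv (h.tail huv)
  have h1 := P.lmarginal_mul_kerProd (N := Finset.univ \ {A}) hTD hDA
    (fun v hv u _ huv => hpar v hv u huv) (ψ := fun _ => 1) measurable_const
    (fun _ _ _ => rfl) x
  have h2 := P.lmarginal_mul_kerProd (N := Finset.univ) hTD (Finset.subset_univ _)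
    (fun v hv u _ huv => hpar v hv u huv) (ψ := fun _ => 1) measurable_const
    (fun _ _ _ => rfl) x
  simp only [one_mul] at h1 h2
  rw [marg, density_eq_kerProd]
  exact h1.trans h2.symm

end CausalModel

/-! ### Densities and means of a causal model -/

/-- The integral of coordinate `v` against the density `g` in the coordinates in `s`, the other
coordinates being those of `x`. -/
noncomputable def coordIntegral {V : Type*} [DecidableEq V] (μ : V → Measure ℝ) (s : Finset V)
    (v : V) (g : (V → ℝ) → ℝ≥0∞) (x : V → ℝ) : ℝ :=
  rmarg μ s (fun x => x v * (g x).toReal) x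

theorem measurable_ofReal_abs : Measurable fun t : ℝ => ENNReal.ofReal |t| :=
  measurable_norm.ennreal_ofReal

theorem dependsOn_comp_apply {V β : Type*} (φ : ℝ → β) (v : V) :
    DependsOn (fun x : V → ℝ => φ (x v)) {v} := fun _ _ h => congrArg φ (h v rfl)

section

variable {V : Type*} [DecidableEq V] {μ : V → Measure ℝ}

theorem dependsOn_rmarg {β : Set V} {F : (V → ℝ) → ℝ} (hF : DependsOn F β) (s : Finset V) :
    DependsOn (rmarg μ s F) (β \ s) := by
  intro x y h
  unfold rmarg
  refine integral_congr_ae (.of_forall fun z => hF fun i hi => ?_)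
  by_cases his : i ∈ s
  · simp [Function.updateFinset, his]
  · simpa [Function.updateFinset, his] using h i ⟨hi, his⟩

theorem updateFinset_update {s : Finset V} {v : V} (hv : v ∉ s) (x : V → ℝ) (a : ℝ) (y : s → ℝ) :
    Function.update (Function.updateFinset x s y) v a =
      Function.updateFinset (Function.update x v a) s y := by
  funext i
  by_cases hi : i = v
  · subst hi
    simp [Function.updateFinset, hv]
  · by_cases his : i ∈ s <;> simp [Function.updateFinset, hi, his]

/-- Fubini's theorem for the mean of a coordinate, with a weight pulled out of the inner
integral. -/
theorem coordIntegral_union [∀ v, SigmaFinite (μ v)] {s t : Finset V} (hst : Disjoint s t) {v : V}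
    {g : (V → ℝ) → ℝ≥0∞} (hg : Measurable g) (hgfin : ∀ x, g x ≠ ∞) {x : V → ℝ}
    (hfin : lmarginal μ (s ∪ t) (fun x => ENNReal.ofReal |x v| * g x) x < ∞) :
    (Integrable (fun y : s → ℝ => coordIntegral μ t v g (Function.updateFinset x s y))
        (Measure.pi fun i : s => μ i) ∧
      coordIntegral μ (s ∪ t) v g x = rmarg μ s (coordIntegral μ t v g) x) ∧
      ∀ᵐ y ∂Measure.pi (fun i : s => μ i),
        lmarginal μ t (fun x => ENNReal.ofReal |x v| * g x) (Function.updateFinset x s y) < ∞ := by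
  have hm : Measurable (fun x : V → ℝ => ENNReal.ofReal |x v| * g x) :=
    ((measurable_pi_apply v).norm.ennreal_ofReal).mul hg
  refine ⟨integrable_rmarg_and_rmarg_union hst
    ((measurable_pi_apply v).mul hg.ennreal_toReal) (lt_of_le_of_lt (le_of_eq ?_) hfin), ?_⟩
  · congr 1
    funext z
    rw [Real.enorm_eq_ofReal_abs]
    change ENNReal.ofReal |z v * (g z).toReal| = _
    rw [abs_mul, abs_of_nonneg ENNReal.toReal_nonneg,
      ENNReal.ofReal_mul (abs_nonneg _), ENNReal.ofReal_toReal (hgfin z)]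
  · rw [lmarginal_union _ _ hm hst] at hfin
    exact ae_lt_top_of_lmarginal_lt_top (hm.lmarginal μ) hfin

/-- If the integral of `F` over the coordinates on which it depends is finite, then `F` is finite
almost everywhere. -/
theorem ae_lt_top_of_dependsOn [Fintype V] [∀ v, SigmaFinite (μ v)] {T : Finset V}
    {F : (V → ℝ) → ℝ≥0∞} (hFm : Measurable F) (hF : DependsOn F (T : Set V)) {x₀ : V → ℝ}
    (hfin : lmarginal μ T F x₀ < ∞) : ∀ᵐ x ∂Measure.pi μ, F x < ∞ := by
  have hae := ae_lt_top_of_lmarginal_lt_top hFm hfin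
  set I : (V → ℝ) → ℝ≥0∞ := {x | F x = ∞}.indicator 1 with hI
  have hset : MeasurableSet {x | F x = ∞} := hFm (measurableSet_singleton ∞)
  have hIm : Measurable I := measurable_one.indicator hset
  have hzero : ∀ x, lmarginal μ T I x = 0 := by
    intro x
    refine (lintegral_congr_ae ?_).trans lintegral_zero
    filter_upwards [hae] with y hy
    have : F (Function.updateFinset x T y) = F (Function.updateFinset x₀ T y) :=
      hF fun i hi => by
        have hi' : i ∈ T := hi
        simp [Function.updateFinset, hi']
    have hne : Function.updateFinset x T y ∉ {x | F x = ∞} := by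
      rw [Set.mem_ofPred_eq, this]
      exact hy.ne
    simp [hI, hne]
  have hnull : Measure.pi μ {x | F x = ∞} = 0 := by
    rw [← lintegral_indicator_one hset, lintegral_eq_lmarginal_univ x₀,
      ← Finset.union_compl T, lmarginal_union' μ _ hIm disjoint_compl_right]
    have : lmarginal μ T I = fun _ => 0 := funext hzero
    rw [this]
    simp [lmarginal]
  refine ae_iff.2 (measure_mono_null (fun x hx => ?_) hnull)
  simpa using hx

end

namespace CausalModel

variable {V : Type*} [Fintype V] [DecidableEq V] {G : DAG V} (P : CausalModel G)

theorem measurable_comp_mul_kerProd {φ : ℝ → ℝ≥0∞} (hφ : Measurable φ) (v : V) (s : Finset V) :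
    Measurable fun x : V → ℝ => φ (x v) * P.kerProd s x :=
  (hφ.comp (measurable_pi_apply v)).mul (P.measurable_kerProd s)

theorem measurable_marg (T : Finset V) : Measurable (P.marg T) := by
  unfold marg
  rw [density_eq_kerProd]
  exact (P.measurable_kerProd _).lmarginal P.ref

theorem dependsOn_marg (T : Finset V) : DependsOn (P.marg T) (T : Set V) := by
  refine (dependsOn_lmarginal (dependsOn_univ P.density) (Finset.univ \ T)).mono ?_
  intro v hv
  simpa using hv.2

/-- Densities of subsets of the variables are obtained by integrating out variables. -/
theorem lmarginal_marg {S T : Finset V} (hST : S ⊆ T) (x : V → ℝ) :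
    lmarginal P.ref (T \ S) (P.marg T) x = P.marg S x := by
  have hset : Finset.univ \ S = (T \ S) ∪ (Finset.univ \ T) := by
    ext v
    have := @hST v
    simp only [Finset.mem_sdiff, Finset.mem_union, Finset.mem_univ, true_and]
    tauto
  have hm : Measurable P.density := P.density_eq_kerProd ▸ P.measurable_kerProd _
  unfold marg
  rw [hset, lmarginal_union _ _ hm
    (Finset.disjoint_sdiff.mono_left Finset.sdiff_subset)]

theorem marg_empty (x : V → ℝ) : P.marg ∅ x = 1 := by
  rw [marg, density_eq_kerProd, Finset.sdiff_empty, P.lmarginal_kerProd_self]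

theorem ae_marg_ne_top (T : Finset V) : ∀ᵐ x ∂Measure.pi P.ref, P.marg T x ≠ ∞ := by
  have h := ae_lt_top_of_dependsOn (μ := P.ref) (P.measurable_marg T) (P.dependsOn_marg T)
    (x₀ := 0) (by
      have := P.lmarginal_marg (Finset.empty_subset T) 0
      rw [Finset.sdiff_empty, marg_empty] at this
      rw [this]
      exact ENNReal.one_lt_top)
  exact h.mono fun x hx => hx.ne

/-- Densities of observed variables inherit positivity from the joint density. -/
theorem ae_marg {obs T : Finset V} (hpos : P.Positive obs) (hT : T ⊆ obs) :
    ∀ᵐ x ∂Measure.pi P.ref, P.marg T x ≠ 0 ∧ P.marg T x ≠ ∞ := by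
  have h1 : ∀ᵐ x ∂Measure.pi P.ref, P.marg T x ≠ 0 := by
    filter_upwards [ae_ae_updateFinset hpos (obs \ T)] with x hx h0
    rw [← P.lmarginal_marg hT] at h0
    have h0' := ae_eq_zero_of_lmarginal_eq_zero (P.measurable_marg obs) h0
    have hne : Measure.pi (fun i : (obs \ T : Finset V) => P.ref i) ≠ 0 := by
      rw [← Measure.measure_univ_ne_zero, Measure.pi_univ, Finset.prod_ne_zero_iff]
      intro i _
      exact Measure.measure_univ_ne_zero.2 (P.ref_ne_zero i)
    have : NeZero (Measure.pi fun i : (obs \ T : Finset V) => P.ref i) := ⟨hne⟩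
    obtain ⟨y, hy, hy0⟩ := (hx.and h0').exists
    exact hy.ne' hy0
  exact h1.and (P.ae_marg_ne_top T)

/-- Almost everywhere in the coordinates `s`, with the remaining coordinates of `T` at atoms, the
density of the observed variables in `T` is positive and finite. -/
theorem ae_marg_updateFinset {obs T : Finset V} (hpos : P.Positive obs) (hT : T ⊆ obs)
    (s : Finset V) (x : V → ℝ) (hx : ∀ i ∈ T, i ∉ s → P.ref i {x i} ≠ 0) :
    ∀ᵐ y ∂Measure.pi (fun i : s => P.ref i),
      P.marg T (Function.updateFinset x s y) ≠ 0 ∧ P.marg T (Function.updateFinset x s y) ≠ ∞ :=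
  ae_updateFinset P.ref_ne_zero (P.ae_marg hpos hT) s T
    (fun y z h => by simp only [P.dependsOn_marg T h]) x hx

theorem mean_eq_div (v : V) (T : Finset V) (x : V → ℝ) :
    P.mean v T x =
      coordIntegral P.ref (Finset.univ \ T) v (P.kerProd Finset.univ) x / (P.marg T x).toReal := by
  rw [mean, condMean, marg, density_eq_kerProd, coordIntegral]

theorem kerProd_univ (A : V) (x : V → ℝ) :
    P.kerProd Finset.univ x = P.kernel A x * P.kerProd (Finset.univ \ {A}) x := by
  rw [← P.kerProd_insert (by simp)]
  congr 1
  ext v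
  by_cases h : v = A <;> simp [h]

theorem measurable_kernel_coe (v : V) : Measurable fun x => (P.kernel v x : ℝ≥0∞) :=
  (P.measurable_kernel v).coe_nnreal_ennreal

/-- The two conditional probabilities of a binary variable add up to one. -/
theorem kernel_add_kernel {A : V} (hA : P.ref A = Measure.dirac 0 + Measure.dirac 1) (x : V → ℝ) :
    (P.kernel A (Function.update x A 0) : ℝ≥0∞) + P.kernel A (Function.update x A 1) = 1 := by
  have := P.kernel_norm A x
  rw [hA, lintegral_add_measure] at this
  have hm : Measurable fun s => (P.kernel A (Function.update x A s) : ℝ≥0∞) :=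
    (P.measurable_kernel_coe A).comp (measurable_update x)
  rwa [lintegral_dirac' _ hm, lintegral_dirac' _ hm] at this

/-- `E[Y | do(A = a)]` as an integral, over the values of a set `T` of other variables, of partial
means, i.e. integrals of `Y` against the density under `do(A = a)` in the other coordinates. -/
theorem doMean_eq_integral {A Y : V} {a : ℝ} (hint : P.DoIntegrable A Y a) {T : Finset V}
    (hT : A ∉ T) :
    (Integrable (fun y : T → ℝ => coordIntegral P.ref ((Finset.univ \ {A}) \ T) Y
          (P.kerProd (Finset.univ \ {A})) (Function.updateFinset (Function.update 0 A a) T y))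
        (Measure.pi fun i : T => P.ref i) ∧
      P.doMean A Y a = ∫ y : T → ℝ, coordIntegral P.ref ((Finset.univ \ {A}) \ T) Y
        (P.kerProd (Finset.univ \ {A})) (Function.updateFinset (Function.update 0 A a) T y)
        ∂Measure.pi fun i : T => P.ref i) ∧
    ∀ᵐ y ∂Measure.pi (fun i : T => P.ref i), lmarginal P.ref ((Finset.univ \ {A}) \ T)
      (fun x => ENNReal.ofReal |x Y| * P.kerProd (Finset.univ \ {A}) x)
      (Function.updateFinset (Function.update 0 A a) T y) < ∞ := by
  have hset : Finset.univ \ {A} = T ∪ (Finset.univ \ {A}) \ T := by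
    rw [Finset.union_sdiff_of_subset]
    intro v hv
    simpa using fun h : v = A => hT (h ▸ hv)
  have hint' : lmarginal P.ref (Finset.univ \ {A})
      (fun x => ENNReal.ofReal |x Y| * P.kerProd (Finset.univ \ {A}) x)
      (Function.update 0 A a) < ∞ := hint
  have key := coordIntegral_union (μ := P.ref) (v := Y) (x := Function.update 0 A a)
    (g := P.kerProd (Finset.univ \ {A}))
    (Finset.disjoint_sdiff (s := T) (t := Finset.univ \ {A}))
    (P.measurable_kerProd _) (P.kerProd_ne_top _) (by rwa [← hset])
  rw [← hset] at key
  exact key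

/-- The average causal effect as an integral of contrasts of partial means. -/
theorem ace_eq_integral {A Y : V} (hint : ∀ a ∈ ({0, 1} : Set ℝ), P.DoIntegrable A Y a)
    {T : Finset V} (hT : A ∉ T) :
    P.ace A Y = ∫ y : T → ℝ,
      (coordIntegral P.ref ((Finset.univ \ {A}) \ T) Y (P.kerProd (Finset.univ \ {A}))
        (Function.updateFinset (Function.update 0 A 1) T y) -
      coordIntegral P.ref ((Finset.univ \ {A}) \ T) Y (P.kerProd (Finset.univ \ {A}))
        (Function.updateFinset (Function.update 0 A 0) T y)) ∂Measure.pi fun i : T => P.ref i := by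
  have h1 := (P.doMean_eq_integral (hint 1 (by simp)) hT).1
  have h0 := (P.doMean_eq_integral (hint 0 (by simp)) hT).1
  rw [ace, h1.2, h0.2, integral_sub h1.1 h0.1]

end CausalModel

/-! ### The backdoor formula -/

/-- Ancestors come no later in a topological ordering. -/
theorem DAG.le_of_anc {V : Type*} {G : DAG V} {t : V → ℕ} (ht : ∀ u v, G.Adj u v → t u < t v) {u v : V} (h : G.Anc u v) :
    t u ≤ t v := by
  induction h with
  | refl => exact le_rfl
  | tail _ hab ih => exact ih.trans (ht _ _ hab).le

/-- Faithfulness turns the conditional independence of `Y` and `Z` given `A` and `C` into the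
backdoor criterion: a walk from a parent `p` of `A` to `Y` that is open given `C` could be
prolonged to `Z → A ← p ⋯ Y`, where the collider `A` is conditioned on. -/
theorem DAG.not_trail_of_collider {V : Type*} [DecidableEq V] {G : DAG V} {Z A Y : V}
    {C : Finset V} (hZA : G.Adj Z A) (hsep : G.DSep {Z} {Y} (insert A C)) {p : V} (hpA : G.Adj p A)
    (hpC : p ∉ C) (a : V) : ¬ (G.isolate A).Trail C p a Y := by
  suffices H : ∀ b c, (G.isolate A).Trail C p b c → G.Trail (insert A C) Z b c from
    fun h => hsep.not_trail (by simp) (by simp) (H a Y h)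
  have hpA' : p ≠ A := fun h => G.acyclic A (.single (h ▸ hpA))
  intro b c h
  induction h with
  | @edge b h =>
    refine .step (a := A) (.step (a := Z) (.edge (Or.inl hZA)) (Or.inr hpA) ?_ ?_)
      (h.imp (fun h => h.1) fun h => h.1) ?_ ?_
    · exact fun _ => ⟨A, by simp, .refl⟩
    · exact fun h => absurd ⟨hZA, hpA⟩ h
    · exact fun h => absurd h.1 (G.not_adj_of_adj hpA)
    · intro _
      simp [hpA', hpC]
  | @step a b c h hbc hcol hnon ih =>
    have hab : a ≠ A ∧ b ≠ A := by
      rcases h.adj with h | h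
      · exact h.2
      · exact h.2.symm
    have hbc' : c ≠ A := by
      rcases hbc with h | h
      · exact h.2.2
      · exact h.2.1
    refine .step ih (hbc.imp (fun h => h.1) fun h => h.1) ?_ ?_
    · rintro ⟨h1, h2⟩
      obtain ⟨w, hw, hbw⟩ := hcol ⟨⟨h1, hab⟩, h2, hbc', hab.2⟩
      exact ⟨w, by simp [hw], DAG.anc_of_anc_isolate hbw⟩
    · intro h
      have := hnon fun h' => h ⟨h'.1.1, h'.2.1⟩
      simp [this, hab.2]

namespace CausalModel

variable {V : Type*} [Fintype V] [DecidableEq V] {G : DAG V} (P : CausalModel G)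

/-- The backdoor criterion implies the backdoor formula, for each value of the covariates: under
`do(A = a)`, the parents of `A` are independent of `Y` given `C`, so that the factor `P(a | pa(A))`
by which the observational density differs cancels in `E[Y | a, C]`. -/
theorem coordIntegral_do_eq_marg_mul_mean {A Y : V} {C : Finset V} (hYA : Y ≠ A) (hAC : A ∉ C)
    (hAY : ¬ G.Adj Y A) (hC : ∀ c ∈ C, ¬ G.Anc A c)
    (hsep : ∀ p, G.Adj p A → p ∉ C → ∀ a, ¬ (G.isolate A).Trail C p a Y) {x : V → ℝ}
    (hp : P.marg C x ≠ 0 ∧ P.marg C x ≠ ∞)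
    (hq : P.marg (insert A C) x ≠ 0 ∧ P.marg (insert A C) x ≠ ∞)
    (hfin : lmarginal P.ref ((Finset.univ \ {A}) \ C)
      (fun x => ENNReal.ofReal |x Y| * P.kerProd (Finset.univ \ {A}) x) x < ∞) :
    coordIntegral P.ref ((Finset.univ \ {A}) \ C) Y (P.kerProd (Finset.univ \ {A})) x =
      (P.marg C x).toReal * P.mean Y (insert A C) x := by
  classical
  let X : Finset V := {p | G.Adj p A ∧ p ∉ C}
  have hX : ∀ p, p ∈ X ↔ G.Adj p A ∧ p ∉ C := fun p => by simp [X]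
  have hset : (Finset.univ \ {A}) \ C = Finset.univ \ insert A C := by
    ext v
    simp
  obtain ⟨α, β, hαβ⟩ := P.exists_factorization (A := A) (X := X) (C := C) (y := Y)
    (fun h => G.acyclic A (.single ((hX A).1 h).1)) hYA hAC
    (Finset.disjoint_left.2 fun p h => ((hX p).1 h).2) (fun h => hAY ((hX Y).1 h).1)
    (fun p h => hsep p ((hX p).1 h).1 ((hX p).1 h).2) x
  have hkm := P.measurable_kernel_coe A
  have hkdep : DependsOn (fun x => (P.kernel A x : ℝ≥0∞)) {v | v ∈ X ∨ v ∈ C ∨ v = A} := by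
    refine (P.dependsOn_kernel A).mono ?_
    rintro v (rfl | hv)
    · exact Or.inr (Or.inr rfl)
    · by_cases hvC : v ∈ C
      · exact Or.inr (Or.inl hvC)
      · exact Or.inl ((hX v).2 ⟨hv, hvC⟩)
  have h1dep : ∀ T : Set V, DependsOn (fun _ : V → ℝ => (1 : ℝ≥0∞)) T := fun _ _ _ _ => rfl
  have hφdep : ∀ φ : ℝ → ℝ≥0∞, DependsOn (fun x : V → ℝ => φ (x Y)) {v | v = Y ∨ v ∈ C ∨ v = A} :=
    fun φ => (dependsOn_comp_apply φ Y).mono fun v hv => Or.inl hv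
  have hφm : ∀ φ : ℝ → ℝ≥0∞, Measurable φ → Measurable fun x : V → ℝ => φ (x Y) :=
    fun φ hφ => hφ.comp (measurable_pi_apply Y)
  have hmargC : P.marg C x = α (fun _ => 1) * β (fun _ => 1) := by
    rw [← P.lmarginal_do_eq_marg hC, ← hαβ _ _ measurable_const measurable_const (h1dep _) (h1dep _)]
    simp
  have hmargAC : P.marg (insert A C) x = α (fun x => P.kernel A x) * β (fun _ => 1) := by
    rw [marg, density_eq_kerProd, ← hset, ← hαβ _ _ hkm measurable_const hkdep (h1dep _)]
    simp_rw [mul_one, ← P.kerProd_univ A]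
  have hdo : ∀ φ : ℝ → ℝ≥0∞, Measurable φ → lmarginal P.ref ((Finset.univ \ {A}) \ C)
      (fun x => φ (x Y) * P.kerProd (Finset.univ \ {A}) x) x =
        α (fun _ => 1) * β (fun x => φ (x Y)) := by
    intro φ hφ
    rw [← hαβ _ _ measurable_const (hφm φ hφ) (h1dep _) (hφdep φ)]
    simp
  have hobs : ∀ φ : ℝ → ℝ≥0∞, Measurable φ → lmarginal P.ref ((Finset.univ \ {A}) \ C)
      (fun x => φ (x Y) * P.kerProd Finset.univ x) x =
        α (fun x => P.kernel A x) * β (fun x => φ (x Y)) := by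
    intro φ hφ
    rw [← hαβ _ _ hkm (hφm φ hφ) hkdep (hφdep φ)]
    congr 1
    funext z
    rw [P.kerProd_univ A z]
    ring
  have key : ∀ φ : ℝ → ℝ≥0∞, Measurable φ →
      P.marg (insert A C) x * lmarginal P.ref ((Finset.univ \ {A}) \ C)
        (fun x => φ (x Y) * P.kerProd (Finset.univ \ {A}) x) x =
      P.marg C x * lmarginal P.ref ((Finset.univ \ {A}) \ C)
        (fun x => φ (x Y) * P.kerProd Finset.univ x) x := by
    intro φ hφ
    rw [hdo φ hφ, hobs φ hφ, hmargC, hmargAC]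
    ring
  have hfin' : lmarginal P.ref ((Finset.univ \ {A}) \ C)
      (fun x => ENNReal.ofReal |x Y| * P.kerProd Finset.univ x) x < ∞ := by
    have h := key _ measurable_ofReal_abs
    by_contra hcon
    rw [not_lt, top_le_iff] at hcon
    rw [hcon, ENNReal.mul_top hp.1] at h
    exact ENNReal.mul_ne_top hq.2 hfin.ne h
  have htr := rmarg_transport (P.measurable_kerProd _) (P.measurable_kerProd _)
    (P.kerProd_ne_top _) (P.kerProd_ne_top _) hfin hfin' key
  rw [mean_eq_div, ← hset, mul_div_assoc', eq_div_iff (ENNReal.toReal_ne_zero.2 hq), mul_comm]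
  exact htr

/-- The backdoor formula for the average causal effect. -/
theorem ace_eq_backdoor {obs : Finset V} {A Y : V} {C : Finset V}
    (hA : P.ref A = Measure.dirac 0 + Measure.dirac 1) (hpos : P.Positive obs)
    (hobs : insert A C ⊆ obs) (hint : ∀ a ∈ ({0, 1} : Set ℝ), P.DoIntegrable A Y a)
    (hYA : Y ≠ A) (hAC : A ∉ C)
    (hAY : ¬ G.Adj Y A) (hC : ∀ c ∈ C, ¬ G.Anc A c)
    (hsep : ∀ p, G.Adj p A → p ∉ C → ∀ a, ¬ (G.isolate A).Trail C p a Y) :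
    P.ace A Y = P.backdoor A Y C := by
  rw [P.ace_eq_integral hint hAC, backdoor]
  have hcond : ∀ a ∈ ({0, 1} : Set ℝ), ∀ᵐ y ∂Measure.pi (fun i : C => P.ref i),
      coordIntegral P.ref ((Finset.univ \ {A}) \ C) Y (P.kerProd (Finset.univ \ {A}))
        (Function.updateFinset (Function.update 0 A a) C y) =
      (P.marg C (Function.updateFinset 0 C y)).toReal *
        P.mean Y (insert A C) (Function.update (Function.updateFinset 0 C y) A a) := by
    intro a ha
    have hatom : P.ref A {a} ≠ 0 := by
      rw [hA]
      rcases ha with rfl | rfl <;> simp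
    filter_upwards [(P.doMean_eq_integral (hint a ha) hAC).2,
      P.ae_marg_updateFinset hpos (fun v hv => hobs (Finset.mem_insert_of_mem hv)) C
        (Function.update 0 A a) (T := C) (fun i hi hi' => absurd hi hi'),
      P.ae_marg_updateFinset hpos hobs C (Function.update 0 A a) (fun i hi hi' => by
        rcases Finset.mem_insert.1 hi with rfl | hi
        · simpa using hatom
        · exact absurd hi hi')] with y h1 h2 h3
    rw [P.coordIntegral_do_eq_marg_mul_mean hYA hAC hAY hC hsep h2 h3 h1,
      updateFinset_update hAC]
    congr 2
    refine P.dependsOn_marg C fun i hi => ?_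
    have hi' : i ∈ C := hi
    simp [Function.updateFinset, hi']
  refine integral_congr_ae ?_
  filter_upwards [hcond 0 (by simp), hcond 1 (by simp)] with y h0 h1
  rw [h0, h1, mul_sub]

end CausalModel

/-! ### Latent parents of mediators are confounders -/

namespace CausalModel

variable {V : Type*} [Fintype V] [DecidableEq V] {G : DAG V}

open Classical in
/-- The model in which `w` is a fair coin, each `v ∈ S` is a noisy copy of its parent `pred v`,
correct with probability `c v`, and all other variables are constantly `0`. Values other than `1`
are read as `0`. -/
noncomputable def copyModel (G : DAG V) (w : V) (S : Finset V) (pred : V → V)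
    (hpred : ∀ v ∈ S, G.Adj (pred v) v) (c : V → ℝ≥0) (hc : ∀ v, c v ≤ 1) : CausalModel G where
  ref v := if v = w ∨ v ∈ S then Measure.dirac 0 + Measure.dirac 1 else Measure.dirac 0
  sigmaFinite_ref v := by split_ifs <;> infer_instance
  kernel v x := if v = w then 1 / 2 else
    if v ∈ S then (if x v = 1 ↔ x (pred v) = 1 then c v else 1 - c v) else 1
  measurable_kernel v := by
    split_ifs
    · exact measurable_const
    · refine Measurable.ite ?_ measurable_const measurable_const
      have h : ∀ u : V, MeasurableSet {x : V → ℝ | x u = 1} := fun u =>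
        measurable_pi_apply u (measurableSet_singleton 1)
      exact (h v).iff (h (pred v))
    · exact measurable_const
  kernel_local v x y hv hpa := by
    by_cases h2 : v ∈ S
    · simp only [hv, hpa _ (hpred v h2)]
    · simp only [h2, if_false]
  kernel_norm v x := by
    by_cases h1 : v = w
    · simp only [h1, if_true, true_or, lintegral_const]
      rw [Measure.add_apply]
      simp only [measure_univ]
      rw [one_add_one_eq_two, ENNReal.coe_div two_ne_zero]
      exact ENNReal.div_mul_cancel (by simp) (by simp)
    by_cases h2 : v ∈ S
    · have hne : pred v ≠ v := fun h => G.acyclic v (.single (by simpa [h] using hpred v h2))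
      simp only [h1, h2, if_true, if_false, or_true, Function.update_self,
        Function.update_of_ne hne]
      have hm : Measurable fun s : ℝ =>
          ((if s = 1 ↔ x (pred v) = 1 then c v else 1 - c v : ℝ≥0) : ℝ≥0∞) := by
        refine Measurable.coe_nnreal_ennreal
          (Measurable.ite ?_ measurable_const measurable_const)
        exact (measurableSet_singleton (1 : ℝ)).iff (MeasurableSet.const _)
      rw [lintegral_add_measure, lintegral_dirac' _ hm, lintegral_dirac' _ hm,
        ← ENNReal.coe_add]
      by_cases hx : x (pred v) = 1
      · simp only [hx, iff_true, zero_ne_one, if_false, if_true, tsub_add_cancel_of_le (hc v),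
          ENNReal.coe_one]
      · simp only [hx, iff_false, zero_ne_one, not_true_eq_false, if_false,
          if_true, add_tsub_cancel_of_le (hc v), ENNReal.coe_one]
    · simp [h1, h2]

section copyModel

variable {w : V} {S : Finset V} {pred : V → V} {hpred : ∀ v ∈ S, G.Adj (pred v) v}
  {c : V → ℝ≥0} {hc : ∀ v, c v ≤ 1}

theorem copyModel_kernel_self (x : V → ℝ) :
    (copyModel G w S pred hpred c hc).kernel w x = 1 / 2 := by
  simp [copyModel]

open Classical in
theorem copyModel_kernel_of_mem {v : V} (hvw : v ≠ w) (hv : v ∈ S) (x : V → ℝ) :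
    (copyModel G w S pred hpred c hc).kernel v x =
      if x v = 1 ↔ x (pred v) = 1 then c v else 1 - c v := by
  simp [copyModel, hvw, hv]

theorem copyModel_kernel_of_notMem {v : V} (hvw : v ≠ w) (hv : v ∉ S) (x : V → ℝ) :
    (copyModel G w S pred hpred c hc).kernel v x = 1 := by
  simp [copyModel, hvw, hv]

theorem copyModel_ref_of_mem {v : V} (hv : v = w ∨ v ∈ S) :
    (copyModel G w S pred hpred c hc).ref v = Measure.dirac 0 + Measure.dirac 1 := by
  simp only [copyModel, hv, if_true]

theorem copyModel_ref_zero (v : V) : (copyModel G w S pred hpred c hc).ref v {0} ≠ 0 := by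
  simp only [copyModel]
  split_ifs <;> simp

end copyModel

open Classical in
/-- The conditional probability of the value of a variable `v` among `m`, `Y` given the fair coin
`w` in the model of the next lemma; the other variables are constants. -/
noncomputable def noisyCopy (m Y w v : V) (x : V → ℝ) : ℝ≥0 :=
  if v = m ∨ v = Y then (if x v = 1 ↔ x w = 1 then 3 / 4 else 1 / 4) else 1

/-- A latent parent `w` of `m` that also causes `Y` can act as a common cause of `m` and `Y`: there
is a model in which it is a fair coin and given it `m` and `Y` are independent noisy copies of
it, correct with probability `3 / 4`, all other observed variables being constant. (Latent variables
on a path from `w` to `Y` copy `w` exactly.) -/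
theorem exists_confounded_model {obs : Finset V} {w m Y : V} (hw : w ∉ obs)
    (hm : m ∈ obs) (hY : Y ∈ obs) (hmY : m ≠ Y) (hwm : G.Adj w m) (hcauses : G.Causes obs w Y) :
    ∃ Q : CausalModel G, Q.ref w = Measure.dirac 0 + Measure.dirac 1 ∧
      Q.ref Y = Measure.dirac 0 + Measure.dirac 1 ∧ (∀ v, Q.ref v {0} ≠ 0) ∧
      (∀ v ∈ obs, v ≠ m → v ≠ Y → ∀ x, Q.kernel v x = 1) ∧
      ∀ O ⊆ obs, ∀ x, lmarginal Q.ref (Finset.univ \ obs)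
        (Q.kerProd ((Finset.univ \ obs) ∪ O)) x =
          lmarginal Q.ref {w} (fun x => ((1 / 2 : ℝ≥0) : ℝ≥0∞) *
            ∏ v ∈ O, (noisyCopy m Y w v x : ℝ≥0∞)) x := by
  classical
  obtain ⟨t, ht⟩ := G.exists_topological_order
  let D : Finset V := {d | Relation.ReflTransGen (fun a b => G.Adj a b ∧ b ∉ obs) w d}
  have memD : ∀ d, d ∈ D ↔ Relation.ReflTransGen (fun a b => G.Adj a b ∧ b ∉ obs) w d :=
    fun d => by simp [D]
  have hwD : w ∈ D := (memD w).2 .refl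
  have hDobs : ∀ d ∈ D, d ∉ obs := fun d hd => by
    rcases Relation.ReflTransGen.cases_tail ((memD d).1 hd) with h | ⟨e, -, h⟩
    · exact h ▸ hw
    · exact h.2
  obtain ⟨wY, hwY, hwYadj⟩ := hcauses
  let S : Finset V := insert m (insert Y (D.erase w))
  have hex : ∀ v, ∃ u, v ∈ S → G.Adj u v ∧ u ∈ D := by
    intro v
    by_cases hvm : v = m
    · exact ⟨w, fun _ => ⟨hvm ▸ hwm, hwD⟩⟩
    by_cases hvY : v = Y
    · exact ⟨wY, fun _ => ⟨hvY ▸ hwYadj, (memD _).2 hwY⟩⟩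
    by_cases hvD : v ∈ D.erase w
    · have hv := Finset.mem_erase.1 hvD
      rcases Relation.ReflTransGen.cases_tail ((memD v).1 hv.2) with h | ⟨e, he, h⟩
      · exact absurd h hv.1
      · exact ⟨e, fun _ => ⟨h.1, (memD e).2 he⟩⟩
    · refine ⟨w, fun hv => ?_⟩
      simp only [S, Finset.mem_insert] at hv
      tauto
  choose pred hpred using hex
  let c : V → ℝ≥0 := fun v => if v ∈ obs then 3 / 4 else 1
  have hc : ∀ v, c v ≤ 1 := fun v => by
    simp only [c]
    split_ifs
    · rw [div_le_one (by norm_num)]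
      norm_num
    · exact le_rfl
  have hquarter : (1 : ℝ≥0) - 3 / 4 = 1 / 4 := by
    rw [tsub_eq_iff_eq_add_of_le]
    · rw [← add_div]; norm_num
    · rw [div_le_one (by norm_num)]; norm_num
  let Q := copyModel G w S pred (fun v hv => (hpred v hv).1) c hc
  have hmS : m ∈ S := by simp [S]
  have hYS : Y ∈ S := by simp [S]
  have hsupp : ∀ v ∈ obs, v ≠ m → v ≠ Y → v ∉ S := by
    intro v hv hvm hvY h
    simp only [S, Finset.mem_insert, Finset.mem_erase] at h
    rcases h with h | h | h
    exacts [hvm h, hvY h, hDobs v h.2 hv]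
  have hone : ∀ v ∈ obs, v ≠ m → v ≠ Y → ∀ x, Q.kernel v x = 1 := fun v hv hvm hvY x =>
    copyModel_kernel_of_notMem (fun h : v = w => hw (h ▸ hv)) (hsupp v hv hvm hvY) x
  refine ⟨Q, copyModel_ref_of_mem (Or.inl rfl), copyModel_ref_of_mem (Or.inr hYS),
    copyModel_ref_zero, hone, ?_⟩
  intro O hO x
  set U := Finset.univ \ obs with hU
  have hwU : w ∈ U := by simp [hU, hw]
  -- almost surely, all variables in `D` agree with the coin
  have hagree : ∀ x, Q.kerProd (U \ {w}) x ≠ 0 → ∀ n, ∀ d ∈ D, t d ≤ n →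
      (x d = 1 ↔ x w = 1) := by
    intro x hx n
    induction n with
    | zero =>
      intro d hd htd
      by_cases hdw : d = w
      · rw [hdw]
      · have hdS : d ∈ S := by simp [S, hd, hdw]
        have := ht _ _ (hpred d hdS).1
        omega
    | succ n ih =>
      intro d hd htd
      by_cases hdw : d = w
      · rw [hdw]
      · have hdS : d ∈ S := by simp [S, hd, hdw]
        have hlt := ht _ _ (hpred d hdS).1
        rw [← ih (pred d) (hpred d hdS).2 (by omega)]
        have hdU : d ∈ U \ {w} := by simp [hU, hdw, hDobs d hd]
        have hk := Finset.prod_ne_zero_iff.1 hx d hdU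
        by_contra hcon
        refine hk ?_
        rw [copyModel_kernel_of_mem hdw hdS, if_neg hcon]
        simp [c, hDobs d hd]
  have hkernel : ∀ x, Q.kerProd (U \ {w}) x ≠ 0 → ∀ v ∈ obs, Q.kernel v x = noisyCopy m Y w v x := by
    intro x hx v hv
    by_cases hvm : v = m ∨ v = Y
    · have hvS : v ∈ S := by rcases hvm with rfl | rfl <;> assumption
      have hvw : v ≠ w := fun h => hw (h ▸ hv)
      rw [copyModel_kernel_of_mem hvw hvS]
      simp only [noisyCopy, hvm, if_true, hagree x hx _ _ (hpred v hvS).2 le_rfl, c, hv, hquarter]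
    · push Not at hvm
      rw [hone v hv hvm.1 hvm.2]
      simp [noisyCopy, hvm.1, hvm.2]
  have hUO : U ∪ O = (U \ {w}) ∪ insert w O := by
    ext v
    by_cases h : v = w <;> simp [h, hwU]
  have hdisj : Disjoint (U \ {w}) (insert w O) := by
    rw [Finset.disjoint_left]
    intro v hv hv'
    have hv1 := Finset.mem_sdiff.1 hv
    rcases Finset.mem_insert.1 hv' with rfl | h
    · simp at hv1
    · exact (Finset.mem_sdiff.1 hv1.1).2 (hO h)
  set F : (V → ℝ) → ℝ≥0∞ := fun x => ((1 / 2 : ℝ≥0) : ℝ≥0∞) *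
    ∏ v ∈ O, (noisyCopy m Y w v x : ℝ≥0∞) with hF
  have hprod : Q.kerProd (U ∪ O) = fun x => F x * Q.kerProd (U \ {w}) x := by
    funext z
    rw [hUO, Q.kerProd_union hdisj, Q.kerProd_insert (fun h => hw (hO h)), mul_comm]
    by_cases hz : Q.kerProd (U \ {w}) z = 0
    · rw [hz]; simp
    · congr 1
      rw [copyModel_kernel_self]
      congr 1
      exact Finset.prod_congr rfl fun v hv => by rw [hkernel z hz v (hO hv)]
  have hFdep : DependsOn F ((U \ {w} : Finset V) : Set V)ᶜ := by
    intro y z h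
    simp only [hF]
    congr 1
    refine Finset.prod_congr rfl fun v hv => ?_
    have h1 : y v = z v := h v (by simp [hU, hO hv])
    have h2 : y w = z w := h w (by simp)
    simp only [noisyCopy, h1, h2]
  have hFm : Measurable F := by
    refine measurable_const.mul (Finset.measurable_prod _ fun v _ => ?_)
    refine Measurable.coe_nnreal_ennreal ?_
    unfold noisyCopy
    split_ifs
    · refine Measurable.ite ?_ measurable_const measurable_const
      have h : ∀ u : V, MeasurableSet {x : V → ℝ | x u = 1} := fun u =>
        measurable_pi_apply u (measurableSet_singleton 1)
      exact (h v).iff (h w)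
    · exact measurable_const
  have hUw : U = {w} ∪ U \ {w} := by
    rw [Finset.union_sdiff_of_subset (by simpa using hwU)]
  rw [hprod]
  have hsplit : lmarginal Q.ref U (fun x => F x * Q.kerProd (U \ {w}) x) =
      lmarginal Q.ref ({w} ∪ U \ {w}) (fun x => F x * Q.kerProd (U \ {w}) x) := by rw [← hUw]
  rw [hsplit, lmarginal_union Q.ref (fun x => F x * Q.kerProd (U \ {w}) x)
    (hFm.mul (Q.measurable_kerProd _)) Finset.disjoint_sdiff]
  congr 1
  funext z
  rw [lmarginal_mul_left hFdep (Q.measurable_kerProd _), Q.lmarginal_kerProd_self, mul_one]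

end CausalModel

open CausalModel in
/-- If `P(V ∖ M | do(m)) = P(V) / P(M | B)` in every model of the graph, where `V` consists of `M`,
`B` and `Y`, then no latent parent of an element of `M` is a cause of `Y`: otherwise the identity
fails in a model where the two are confounded. -/
theorem DAG.SupportsGFormula.not_causes {V : Type*} [Fintype V] [DecidableEq V] {G : DAG V}
    {obs M B : Finset V} {Y : V} (h : G.SupportsGFormula obs M B) (hobs : obs = insert Y (M ∪ B))
    (hYM : Y ∉ M) (hYB : Y ∉ B) (hMB : Disjoint M B) {w m : V} (hw : w ∉ obs) (hm : m ∈ M)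
    (hwm : G.Adj w m) : ¬ G.Causes obs w Y := by
  intro hcauses
  have hMobs : M ⊆ obs := fun v hv => by simp [hobs, hv]
  have hBobs : B ⊆ obs := fun v hv => by simp [hobs, hv]
  have hY : Y ∈ obs := by simp [hobs]
  have hmY : m ≠ Y := fun h => hYM (h ▸ hm)
  have hYw : Y ≠ w := fun h => hw (h ▸ hY)
  have hmw : m ≠ w := fun h => hw (h ▸ hMobs hm)
  obtain ⟨Q, hrefw, hrefY, hatom, hone, hmarg⟩ :=
    CausalModel.exists_confounded_model hw (hMobs hm) hY hmY hwm hcauses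
  have hsum : ∀ O ⊆ obs, ∀ x, lmarginal Q.ref (Finset.univ \ obs)
      (Q.kerProd ((Finset.univ \ obs) ∪ O)) x =
        ((1 / 2 * (∏ v ∈ O, noisyCopy m Y w v (Function.update x w 0) +
          ∏ v ∈ O, noisyCopy m Y w v (Function.update x w 1)) : ℝ≥0) : ℝ≥0∞) := by
    intro O hO x
    rw [hmarg O hO x, lmarginal_singleton_of_binary hrefw, mul_add]
    push_cast
    rfl
  have hmobs : ∀ x, Q.marg obs x =
      ((1 / 2 * (noisyCopy m Y w m (Function.update x w 0) *
          noisyCopy m Y w Y (Function.update x w 0) +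
        noisyCopy m Y w m (Function.update x w 1) *
          noisyCopy m Y w Y (Function.update x w 1)) : ℝ≥0) : ℝ≥0∞) := by
    intro x
    have hprod : ∀ z, ∏ v ∈ obs, noisyCopy m Y w v z =
        noisyCopy m Y w m z * noisyCopy m Y w Y z := fun z =>
      Finset.prod_eq_mul m Y hmY (fun v _ hv => by simp [noisyCopy, hv.1, hv.2])
        (fun h => absurd (hMobs hm) h) (fun h => absurd hY h)
    rw [marg, density_eq_kerProd, ← hprod, ← hprod, ← hsum obs subset_rfl,
      Finset.sdiff_union_of_subset (Finset.subset_univ _)]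
  have hdo : lmarginal Q.ref (Finset.univ \ obs) (Q.doDensity M) 0 = ((1 / 2 : ℝ≥0) : ℝ≥0∞) := by
    have hset : Finset.univ \ M = (Finset.univ \ obs) ∪ obs \ M := by
      ext v
      have := @hMobs v
      simp only [Finset.mem_sdiff, Finset.mem_union, Finset.mem_univ, true_and]
      tauto
    have hprod : ∀ z, ∏ v ∈ obs \ M, noisyCopy m Y w v z = noisyCopy m Y w Y z := fun z =>
      Finset.prod_eq_single Y (fun v hv hvY => by
        have hvm : v ≠ m := fun h => (Finset.mem_sdiff.1 hv).2 (h ▸ hm)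
        simp [noisyCopy, hvm, hvY]) (fun h => absurd (by simp [hY, hYM]) h)
    change lmarginal Q.ref (Finset.univ \ obs) (Q.kerProd (Finset.univ \ M)) 0 = _
    rw [hset, hsum _ Finset.sdiff_subset, hprod, hprod]
    simp only [noisyCopy, or_true, if_true, Function.update_self, Function.update_of_ne hYw]
    norm_num
  have hB : Q.marg B 0 = 1 := by
    have h1 : ∀ x, Q.kerProd B x = 1 := fun x => Finset.prod_eq_one fun v hv => by
      rw [hone v (hBobs hv) (fun h => Finset.disjoint_left.1 hMB hm (h ▸ hv))
        (fun h => hYB (h ▸ hv)), ENNReal.coe_one]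
    have h2 : Q.density = Q.kerProd (Finset.univ \ B) := by
      funext x
      rw [density_eq_kerProd, ← Finset.union_sdiff_of_subset (Finset.subset_univ B),
        Q.kerProd_union Finset.disjoint_sdiff, h1, one_mul,
        Finset.union_sdiff_of_subset (Finset.subset_univ B)]
    rw [marg, h2, Q.lmarginal_kerProd_self]
  have hMB' : Q.marg (M ∪ B) 0 = ((1 / 2 : ℝ≥0) : ℝ≥0∞) := by
    have hset : obs \ (M ∪ B) = {Y} := by
      rw [hobs, Finset.insert_sdiff_of_notMem _ (by simp [hYM, hYB]), Finset.sdiff_self]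
      rfl
    rw [← Q.lmarginal_marg (T := obs) (Finset.union_subset hMobs hBobs), hset,
      lmarginal_singleton_of_binary hrefY, hmobs, hmobs, ← ENNReal.coe_add]
    simp only [noisyCopy, or_true, true_or, if_true, Function.update_self,
      Function.update_of_ne hYw, Function.update_of_ne hmw, Function.update_of_ne hmY]
    norm_num
  have hobs0 : Q.marg obs 0 = ((5 / 16 : ℝ≥0) : ℝ≥0∞) := by
    rw [hmobs]
    simp only [noisyCopy, or_true, true_or, if_true, Function.update_self,
      Function.update_of_ne hYw, Function.update_of_ne hmw]
    norm_num
  have hpos : Q.Positive obs := by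
    have hpos' : ∀ v z, 0 < noisyCopy m Y w v z := by
      intro v z
      unfold noisyCopy
      split_ifs <;> norm_num
    refine .of_forall fun x => ?_
    rw [hmobs, ENNReal.coe_pos]
    exact mul_pos (by norm_num) (add_pos (mul_pos (hpos' _ _) (hpos' _ _))
      (mul_pos (hpos' _ _) (hpos' _ _)))
  have hae := h Q hpos
  have h0 : Measure.pi Q.ref {0} ≠ 0 := by
    rw [Measure.pi_singleton, Finset.prod_ne_zero_iff]
    exact fun v _ => hatom v
  have heq : lmarginal Q.ref (Finset.univ \ obs) (Q.doDensity M) 0 = Q.verma obs M B 0 := by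
    by_contra hcon
    exact h0 (measure_mono_null (by simpa using hcon) (ae_iff.1 hae))
  rw [hdo, CausalModel.verma, CausalModel.cond, hB, hMB', hobs0, div_one,
    ← ENNReal.coe_div (by norm_num), ENNReal.coe_inj] at heq
  have := congrArg NNReal.toReal heq
  norm_num at this

/-! ### The frontdoor formula -/

theorem DAG.anc_of_anc_doGraph {V : Type*} {G : DAG V} {S : Finset V} {u v : V}
    (h : (G.doGraph S).Anc u v) : G.Anc u v :=
  Relation.ReflTransGen.mono (fun _ _ hab => hab.1) _ _ h

namespace CausalModel

variable {V : Type*} [Fintype V] [DecidableEq V] {G : DAG V} (P : CausalModel G)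

section frontdoor

variable {A Y : V} {M L : Finset V}

theorem dependsOn_kerProd_of_parents
    (hpa : ∀ m ∈ M, ∀ u, G.Adj u m → u ∈ insert A (M ∪ L)) :
    DependsOn (P.kerProd M) (insert A (M ∪ L) : Finset V) := by
  refine (P.dependsOn_kerProd M).mono ?_
  rintro u ⟨m, hm, rfl | hu⟩
  · simp [hm]
  · exact hpa m hm u hu

/-- If all parents of the mediators are among `A`, `L` and the mediators, then the conditional
density `P(m | a, l)` is the product of the conditional densities of the mediators. -/
theorem marg_mediators (hpa : ∀ m ∈ M, ∀ u, G.Adj u m → u ∈ insert A (M ∪ L))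
    (hanc : ∀ m ∈ M, ∀ v ∈ insert A L, ¬ G.Anc m v) (x : V → ℝ) :
    P.marg (insert A (M ∪ L)) x = P.kerProd M x * P.marg (insert A L) x := by
  classical
  let D : Finset V := {v | ∀ m ∈ M, ¬ G.Anc m v}
  have memD : ∀ v, v ∈ D ↔ ∀ m ∈ M, ¬ G.Anc m v := fun v => by simp [D]
  have hpar : ∀ v ∈ D, ∀ u, G.Adj u v → u ∈ D := fun v hv u huv =>
    (memD u).2 fun m hm h => (memD v).1 hv m hm (h.tail huv)
  have hTD : insert A L ⊆ D := fun v hv => (memD v).2 fun m hm => hanc m hm v hv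
  have hDM : D ⊆ Finset.univ \ M := fun v hv => by
    simp only [Finset.mem_sdiff, Finset.mem_univ, true_and]
    exact fun h => (memD v).1 hv v h .refl
  have h1 := P.lmarginal_mul_kerProd (N := Finset.univ \ M) hTD hDM
    (fun v hv u _ huv => hpar v hv u huv) (ψ := fun _ => 1) measurable_const
    (fun _ _ _ => rfl) x
  have h2 := P.lmarginal_mul_kerProd (N := Finset.univ) hTD (Finset.subset_univ _)
    (fun v hv u _ huv => hpar v hv u huv) (ψ := fun _ => 1) measurable_const
    (fun _ _ _ => rfl) x
  simp only [one_mul] at h1 h2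
  have hset : Finset.univ \ insert A (M ∪ L) = (Finset.univ \ M) \ insert A L := by
    ext v
    simp
    tauto
  have hprod : P.density = fun x => P.kerProd M x * P.kerProd (Finset.univ \ M) x := by
    funext z
    rw [density_eq_kerProd, ← P.kerProd_union Finset.disjoint_sdiff,
      Finset.union_sdiff_of_subset (Finset.subset_univ _)]
  have hdep : DependsOn (P.kerProd M) ((Finset.univ \ insert A (M ∪ L) : Finset V) : Set V)ᶜ :=
    (P.dependsOn_kerProd_of_parents hpa).mono fun v hv => by
      have hv' : v ∈ insert A (M ∪ L) := hv
      simp only [Set.mem_compl_iff, Finset.mem_coe, Finset.mem_sdiff, hv', not_true_eq_false,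
        and_false, not_false_eq_true]
  have h3 : P.marg (insert A (M ∪ L)) x = P.kerProd M x *
      lmarginal P.ref ((Finset.univ \ M) \ insert A L) (P.kerProd (Finset.univ \ M)) x := by
    rw [marg, hprod, lmarginal_mul_left hdep (P.measurable_kerProd _), hset]
  rw [h3, h1, ← h2, marg, density_eq_kerProd]

/-- If `A` affects `Y` only through the mediators `M` and does not affect `L`, then under `do(m)`
the joint law of `L` and `Y` is the same whether `A` is integrated out or fixed. -/
theorem lmarginal_do_mediators (hAM : A ∉ M) (hAL : A ∉ L) (hML : Disjoint M L) (hYM : Y ∉ M)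
    (hL : ∀ v ∈ L, ¬ G.Anc A v) (hAY : ¬ (G.doGraph M).Anc A Y) {φ : ℝ → ℝ≥0∞} (hφ : Measurable φ)
    (x : V → ℝ) (a : ℝ) :
    lmarginal P.ref (insert A (Finset.univ \ insert A (M ∪ L)))
        (fun x => φ (x Y) * P.kerProd (Finset.univ \ M) x) x =
      lmarginal P.ref (Finset.univ \ insert A (M ∪ L))
        (fun x => φ (x Y) * P.kerProd (Finset.univ \ insert A M) x) (Function.update x A a) := by
  classical
  let D : Finset V := {v | v ∉ M ∧ ¬ (G.doGraph M).Anc A v}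
  have memD : ∀ v, v ∈ D ↔ v ∉ M ∧ ¬ (G.doGraph M).Anc A v := fun v => by simp [D]
  have hpar : ∀ v ∈ D, ∀ u, u ∉ M → G.Adj u v → u ∈ D := fun v hv u hu huv =>
    (memD u).2 ⟨hu, fun h => ((memD v).1 hv).2 (h.tail ⟨huv, ((memD v).1 hv).1⟩)⟩
  have hTD : L ⊆ D := fun v hv => (memD v).2
    ⟨fun h => Finset.disjoint_left.1 hML h hv, fun h => hL v hv (DAG.anc_of_anc_doGraph h)⟩
  have hYD : Y ∈ D := (memD Y).2 ⟨hYM, hAY⟩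
  have hAD : A ∉ D := fun h => ((memD A).1 h).2 .refl
  have hDM : D ⊆ Finset.univ \ M := fun v hv => by simpa using ((memD v).1 hv).1
  have hDAM : D ⊆ Finset.univ \ insert A M := fun v hv => by
    simpa using ⟨fun h : v = A => hAD (h ▸ hv), ((memD v).1 hv).1⟩
  have hψ : ∀ N : Finset V, DependsOn (fun x : V → ℝ => φ (x Y)) ((N \ D : Finset V) : Set V)ᶜ :=
    fun N => (dependsOn_comp_apply φ Y).mono fun v hv => by
      have hv' : v = Y := hv
      simp [hv', hYD]
  have hm := hφ.comp (measurable_pi_apply (X := fun _ : V => ℝ) Y)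
  have h1 := P.lmarginal_mul_kerProd (N := Finset.univ \ M) hTD hDM
    (fun v hv u hu huv => hpar v hv u (by simpa using hu) huv) hm (hψ _) x
  have h2 := P.lmarginal_mul_kerProd (N := Finset.univ \ insert A M) hTD hDAM
    (fun v hv u hu huv => hpar v hv u (fun h => by simp [h] at hu) huv) hm (hψ _)
      (Function.update x A a)
  have hset1 : insert A (Finset.univ \ insert A (M ∪ L)) = (Finset.univ \ M) \ L := by
    ext v
    by_cases hv : v = A
    · simp [hv, hAM, hAL]
    · simp [hv]
  have hset2 : Finset.univ \ insert A (M ∪ L) = (Finset.univ \ insert A M) \ L := by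
    ext v
    simp
    tauto
  have hdep : DependsOn (lmarginal P.ref (D \ L) (fun x => φ (x Y) * P.kerProd D x))
      ({A} : Set V)ᶜ := by
    refine (dependsOn_lmarginal (dependsOn_mul (T := ({A} : Set V)ᶜ) ?_ ?_) (D \ L)).mono
      Set.sdiff_subset
    · exact (dependsOn_comp_apply φ Y).mono fun v hv => by
        rintro rfl
        exact hAD (hv ▸ hYD)
    · refine (P.dependsOn_kerProd D).mono ?_
      rintro u ⟨v, hv, rfl | huv⟩ rfl
      · exact hAD hv
      · exact hAD (hpar v hv u hAM huv)
  rw [hset1]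
  refine h1.trans ?_
  conv_rhs => rw [hset2]
  refine Eq.trans ?_ h2.symm
  exact (apply_update_of_dependsOn hdep (by simp) x a).symm

/-- The conditional frontdoor formula, for mediators all of whose parents are observed, through
which all effects of `A` on `Y` pass. -/
theorem ace_eq_frontdoor {obs : Finset V}
    (hA : P.ref A = Measure.dirac 0 + Measure.dirac 1) (hpos : P.Positive obs)
    (hobs : insert A (M ∪ L) ⊆ obs) (hint : ∀ a ∈ ({0, 1} : Set ℝ), P.DoIntegrable A Y a)
    (hAM : A ∉ M) (hAL : A ∉ L) (hML : Disjoint M L) (hYM : Y ∉ M)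
    (hpa : ∀ m ∈ M, ∀ u, G.Adj u m → u ∈ insert A (M ∪ L))
    (hanc : ∀ m ∈ M, ∀ v ∈ insert A L, ¬ G.Anc m v)
    (hL : ∀ v ∈ L, ¬ G.Anc A v) (hAY : ¬ (G.doGraph M).Anc A Y) :
    P.ace A Y = P.frontdoor A M Y L := by
  have hAML : A ∉ M ∪ L := by simp [hAM, hAL]
  rw [P.ace_eq_integral hint hAML, frontdoor]
  have hset : (Finset.univ \ {A}) \ (M ∪ L) = Finset.univ \ insert A (M ∪ L) := by
    ext v
    simp
  have hkmdep : DependsOn (P.kerProd M) ((Finset.univ \ insert A (M ∪ L) : Finset V) : Set V)ᶜ :=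
    (P.dependsOn_kerProd_of_parents hpa).mono fun v hv => by
      have hv' : v ∈ insert A (M ∪ L) := hv
      simp only [Set.mem_compl_iff, Finset.mem_coe, Finset.mem_sdiff, hv', not_true_eq_false,
        and_false, not_false_eq_true]
  have hsplit : ∀ z, P.kerProd (Finset.univ \ {A}) z =
      P.kerProd M z * P.kerProd (Finset.univ \ insert A M) z := by
    intro z
    rw [← P.kerProd_union]
    · congr 1
      ext v
      by_cases hv : v ∈ M
      · have : v ≠ A := fun h => hAM (h ▸ hv)
        simp [hv, this]
      · simp [hv]
    · exact Finset.disjoint_sdiff.mono_right (Finset.sdiff_subset_sdiff subset_rfl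
        (Finset.subset_insert _ _))
  have hsplit' : ∀ z, P.kerProd Finset.univ z =
      P.kerProd M z * P.kerProd (Finset.univ \ M) z := fun z => by
    rw [← P.kerProd_union Finset.disjoint_sdiff,
      Finset.union_sdiff_of_subset (Finset.subset_univ _)]
  set U := Finset.univ \ insert A (M ∪ L) with hU
  -- the factors `P(m | a, l)` come out of the integrals over the coordinates in `U`
  have hdo : ∀ z, coordIntegral P.ref U Y (P.kerProd (Finset.univ \ {A})) z =
      (P.kerProd M z).toReal * coordIntegral P.ref U Y (P.kerProd (Finset.univ \ insert A M)) z := by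
    intro z
    unfold coordIntegral
    rw [← rmarg_mul_left (F := fun z => (P.kerProd M z).toReal)
      (fun y y' h => congrArg ENNReal.toReal (hkmdep h))]
    congr 1
    funext z
    rw [hsplit, ENNReal.toReal_mul]
    ring
  have hobsi : ∀ z, coordIntegral P.ref U Y (P.kerProd Finset.univ) z =
      (P.kerProd M z).toReal * coordIntegral P.ref U Y (P.kerProd (Finset.univ \ M)) z := by
    intro z
    unfold coordIntegral
    rw [← rmarg_mul_left (F := fun z => (P.kerProd M z).toReal)
      (fun y y' h => congrArg ENNReal.toReal (hkmdep h))]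
    congr 1
    funext z
    rw [hsplit', ENNReal.toReal_mul]
    ring
  have hcond : ∀ a ∈ ({0, 1} : Set ℝ), ∀ᵐ y ∂Measure.pi (fun i : (M ∪ L : Finset V) => P.ref i),
      lmarginal P.ref U (fun x => ENNReal.ofReal |x Y| * P.kerProd (Finset.univ \ insert A M) x)
        (Function.update (Function.updateFinset 0 (M ∪ L) y) A a) < ∞ ∧
      P.cond M (insert A L) (Function.update (Function.updateFinset 0 (M ∪ L) y) A a) =
        P.kerProd M (Function.update (Function.updateFinset 0 (M ∪ L) y) A a) ∧
      (P.marg (insert A L) (Function.update (Function.updateFinset 0 (M ∪ L) y) A a)).toReal *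
        P.mean Y (insert A (M ∪ L)) (Function.update (Function.updateFinset 0 (M ∪ L) y) A a) =
      coordIntegral P.ref U Y (P.kerProd (Finset.univ \ M))
        (Function.update (Function.updateFinset 0 (M ∪ L) y) A a) := by
    intro a ha
    have hatom : P.ref A {a} ≠ 0 := by
      rw [hA]
      rcases ha with rfl | rfl <;> simp
    have hsub : insert A L ⊆ insert A (M ∪ L) :=
      Finset.insert_subset_insert _ Finset.subset_union_right
    have hx : ∀ T, T ⊆ insert A (M ∪ L) → ∀ i ∈ T, i ∉ M ∪ L →
        P.ref i {@Function.update V (fun _ => ℝ) _ 0 A a i} ≠ 0 := fun T hT i hi hi' => by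
      rcases Finset.mem_insert.1 (hT hi) with rfl | h
      · simpa using hatom
      · exact absurd h hi'
    filter_upwards [(P.doMean_eq_integral (hint a ha) hAML).2,
      P.ae_marg_updateFinset hpos hobs (M ∪ L) (Function.update 0 A a) (hx _ subset_rfl),
      P.ae_marg_updateFinset hpos (hsub.trans hobs) (M ∪ L) (Function.update 0 A a)
        (hx _ hsub)] with y h1 h2 h3
    rw [updateFinset_update hAML]
    set z : V → ℝ := Function.updateFinset (Function.update 0 A a) (M ∪ L) y
    have hmarg := P.marg_mediators hpa hanc z
    have hkm : P.kerProd M z ≠ 0 := fun h => h2.1 (by rw [hmarg, h, zero_mul])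
    refine ⟨?_, ?_, ?_⟩
    · rw [hset] at h1
      have hpull : lmarginal P.ref U
          (fun x => ENNReal.ofReal |x Y| * P.kerProd (Finset.univ \ {A}) x) z =
          P.kerProd M z * lmarginal P.ref U
            (fun x => ENNReal.ofReal |x Y| * P.kerProd (Finset.univ \ insert A M) x) z := by
        rw [← lmarginal_mul_left hkmdep (P.measurable_comp_mul_kerProd measurable_ofReal_abs Y _)]
        congr 1
        funext z
        rw [hsplit]
        ring
      rw [hpull] at h1
      exact (ENNReal.mul_lt_top_iff.1 h1).elim (fun h => h.2) (fun h => h.elim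
        (fun h => absurd h hkm) (fun h => by rw [h]; exact ENNReal.zero_lt_top))
    · have hset3 : M ∪ insert A L = insert A (M ∪ L) := by
        ext v
        simp
      rw [cond, hset3, hmarg, ENNReal.mul_div_cancel_right h3.1 h3.2]
    · rw [mean_eq_div, ← hU, hobsi, hmarg, ENNReal.toReal_mul]
      have hkm' : (P.kerProd M z).toReal ≠ 0 := ENNReal.toReal_ne_zero.2 ⟨hkm, P.kerProd_ne_top _ _⟩
      have hma' : (P.marg (insert A L) z).toReal ≠ 0 := ENNReal.toReal_ne_zero.2 h3
      field_simp
  refine integral_congr_ae ?_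
  filter_upwards [hcond 0 (by simp), hcond 1 (by simp)] with y h0 h1
  set x : V → ℝ := Function.updateFinset 0 (M ∪ L) y with hx
  rw [Finset.sum_pair zero_ne_one, h0.2.2, h1.2.2, h0.2.1, h1.2.1, hset, hdo, hdo,
    ← updateFinset_update hAML, ← updateFinset_update hAML, ← hx]
  -- `Ψ φ` is the integral of `φ(Y)` over all coordinates other than `M` and `L` under `do(m)`;
  -- the positive and negative parts of `Y` are treated through `φ = ofReal` and `φ = ofReal ∘ neg`
  set Ψ : (ℝ → ℝ≥0∞) → ℝ≥0∞ := fun φ =>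
    lmarginal P.ref (insert A U) (fun x => φ (x Y) * P.kerProd (Finset.univ \ M) x) x
  have hΨ1 : ∀ φ, Measurable φ → ∀ a, lmarginal P.ref U
      (fun x => φ (x Y) * P.kerProd (Finset.univ \ insert A M) x) (Function.update x A a) = Ψ φ :=
    fun φ hφ a => (P.lmarginal_do_mediators hAM hAL hML hYM hL hAY hφ x a).symm
  have hΨ2 : ∀ φ, Measurable φ →
      lmarginal P.ref U (fun x => φ (x Y) * P.kerProd (Finset.univ \ M) x) (Function.update x A 0) +
        lmarginal P.ref U (fun x => φ (x Y) * P.kerProd (Finset.univ \ M) x)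
          (Function.update x A 1) = Ψ φ := by
    intro φ hφ
    rw [← lmarginal_singleton_of_binary hA, ← lmarginal_union _
      (fun x => φ (x Y) * P.kerProd (Finset.univ \ M) x)
      (P.measurable_comp_mul_kerProd hφ Y _)
      (Finset.disjoint_singleton_left.2 (by simp [hU]))]
    rfl
  have hneg : Measurable fun t : ℝ => ENNReal.ofReal (-t) :=
    ENNReal.measurable_ofReal.comp measurable_neg
  have hfin : Ψ (fun t => ENNReal.ofReal |t|) < ∞ := by
    rw [← hΨ1 _ measurable_ofReal_abs 0]
    exact h0.1
  have hle : ∀ φ : ℝ → ℝ≥0∞, (∀ t, φ t ≤ ENNReal.ofReal |t|) → Ψ φ < ∞ := fun φ hφ =>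
    lt_of_le_of_lt (lmarginal_mono (fun z => mul_le_mul_left (hφ _) _) x) hfin
  have hposfin := hle ENNReal.ofReal fun t => ENNReal.ofReal_le_ofReal (le_abs_self t)
  have hnegfin := hle (fun t => ENNReal.ofReal (-t)) fun t =>
    ENNReal.ofReal_le_ofReal (neg_le_abs t)
  have hI : ∀ a, coordIntegral P.ref U Y (P.kerProd (Finset.univ \ insert A M))
      (Function.update x A a) =
        (Ψ ENNReal.ofReal).toReal - (Ψ fun t => ENNReal.ofReal (-t)).toReal := by
    intro a
    unfold coordIntegral
    rw [rmarg_eq_sub (P.measurable_kerProd _) (P.kerProd_ne_top _) (by rw [hΨ1 _ measurable_ofReal_abs]; exact hfin),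
      hΨ1 _ ENNReal.measurable_ofReal, hΨ1 _ hneg]
  have hJ : coordIntegral P.ref U Y (P.kerProd (Finset.univ \ M)) (Function.update x A 0) +
      coordIntegral P.ref U Y (P.kerProd (Finset.univ \ M)) (Function.update x A 1) =
        (Ψ ENNReal.ofReal).toReal - (Ψ fun t => ENNReal.ofReal (-t)).toReal := by
    have h2 := hΨ2 _ measurable_ofReal_abs
    have h3 := ENNReal.add_lt_top.1 (h2.symm ▸ hfin)
    have hp := hΨ2 _ ENNReal.measurable_ofReal
    have hp' := ENNReal.add_lt_top.1 (hp.symm ▸ hposfin)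
    have hn := hΨ2 _ hneg
    have hn' := ENNReal.add_lt_top.1 (hn.symm ▸ hnegfin)
    unfold coordIntegral
    rw [rmarg_eq_sub (P.measurable_kerProd _) (P.kerProd_ne_top _) h3.1,
      rmarg_eq_sub (P.measurable_kerProd _) (P.kerProd_ne_top _) h3.2, ← hp, ← hn,
      ENNReal.toReal_add hp'.1.ne hp'.2.ne, ENNReal.toReal_add hn'.1.ne hn'.2.ne]
    ring
  rw [hI, hI, hJ]
  ring

end frontdoor

end CausalModel

/-! ### Homogeneous effects -/

section

variable {V : Type*} [DecidableEq V] {μ : V → Measure ℝ}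

theorem rmarg_singleton (v : V) (F : (V → ℝ) → ℝ) (x : V → ℝ) [∀ v, SigmaFinite (μ v)] :
    rmarg μ {v} F x = ∫ s, F (Function.update x v s) ∂μ v := by
  have h := (measurePreserving_piUnique (fun j : ({v} : Finset V) ↦ μ j)).symm
  rw [rmarg, ← h.integral_comp']
  refine integral_congr_ae (.of_forall fun s => ?_)
  simp only [Function.update_eq_updateFinset]
  rfl

theorem rmarg_singleton_of_binary [∀ v, SigmaFinite (μ v)] {v : V}
    (hv : μ v = Measure.dirac 0 + Measure.dirac 1) (F : (V → ℝ) → ℝ) (x : V → ℝ) :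
    rmarg μ {v} F x = F (Function.update x v 0) + F (Function.update x v 1) := by
  rw [rmarg_singleton, hv, integral_add_measure (integrable_dirac (by simp))
    (integrable_dirac (by simp)), integral_dirac, integral_dirac]

theorem dependsOn_coordIntegral (s : Finset V) (v : V) (g : (V → ℝ) → ℝ≥0∞) :
    DependsOn (coordIntegral μ s v g) ((s : Set V)ᶜ) :=
  (dependsOn_rmarg (dependsOn_univ _) s).mono fun _ h => h.2

theorem dependsOn_coordIntegral_update [Fintype V] (A : V) (T : Finset V) (v : V)
    (g : (V → ℝ) → ℝ≥0∞) (a : ℝ) :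
    DependsOn (fun x => coordIntegral μ ((Finset.univ \ {A}) \ T) v g (Function.update x A a))
      (T : Set V) := by
  intro x y h
  refine dependsOn_coordIntegral _ v g fun i hi => ?_
  by_cases hiA : i = A
  · simp [hiA]
  · have hiT : i ∈ T := by simpa [hiA] using hi
    simpa [hiA] using h i hiT

/-- Integrating against the event that coordinate `v` takes a value `b` fixes that coordinate. -/
theorem lmarginal_insert_indicator [∀ v, SigmaFinite (μ v)] {s : Finset V} {v : V} (hv : v ∉ s)
    {F : (V → ℝ) → ℝ≥0∞} (hF : Measurable F) (x : V → ℝ) :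
    lmarginal μ (insert v s) (fun z => ({x v} : Set ℝ).indicator (fun _ => 1) (z v) * F z) x =
      μ v {x v} * lmarginal μ s F x := by
  have hind : Measurable fun z : V → ℝ => ({x v} : Set ℝ).indicator (fun _ => (1 : ℝ≥0∞)) (z v) :=
    (measurable_const.indicator (measurableSet_singleton _)).comp (measurable_pi_apply v)
  rw [lmarginal_insert (fun z => ({x v} : Set ℝ).indicator (fun _ => 1) (z v) * F z)
    (hind.mul hF) hv]
  have h1 : ∀ z : V → ℝ, lmarginal μ s
      (fun z => ({x v} : Set ℝ).indicator (fun _ => 1) (z v) * F z) z =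
        ({x v} : Set ℝ).indicator (fun _ => 1) (z v) * lmarginal μ s F z := fun z =>
    lmarginal_mul_left ((dependsOn_comp_apply _ v).mono fun i (hi : i = v) h => hv (hi ▸ h)) hF z
  simp_rw [h1, Function.update_self]
  have h2 : ∀ t : ℝ, ({x v} : Set ℝ).indicator (fun _ => (1 : ℝ≥0∞)) t *
      lmarginal μ s F (Function.update x v t) =
        ({x v} : Set ℝ).indicator (fun _ => lmarginal μ s F x) t := by
    intro t
    by_cases ht : t = x v
    · simp [ht]
    · simp [ht]
  simp_rw [h2]
  rw [lintegral_indicator_const (measurableSet_singleton _), mul_comm]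

end

namespace CausalModel

variable {V : Type*} [Fintype V] [DecidableEq V] {G : DAG V} (P : CausalModel G)

section instrument

variable {A Y Z : V} {C T W : Finset V}

theorem kernel_le_one (hA : P.ref A = Measure.dirac 0 + Measure.dirac 1) {a : ℝ}
    (ha : a ∈ ({0, 1} : Set ℝ)) (x : V → ℝ) :
    (P.kernel A (Function.update x A a) : ℝ≥0∞) ≤ 1 := by
  rw [← P.kernel_add_kernel hA x]
  rcases ha with rfl | rfl
  · exact le_self_add
  · exact le_add_self

/-- Integrability of `Y` under both interventions gives, almost everywhere, integrability given
the values of a set of variables, under the interventions and in the observational law. -/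
theorem ae_integrable (hA : P.ref A = Measure.dirac 0 + Measure.dirac 1)
    (hint : ∀ a ∈ ({0, 1} : Set ℝ), P.DoIntegrable A Y a) (hAT : A ∉ T) :
    ∀ᵐ x ∂Measure.pi P.ref,
      (∀ a ∈ ({0, 1} : Set ℝ), lmarginal P.ref ((Finset.univ \ {A}) \ T)
        (fun x => ENNReal.ofReal |x Y| * P.kerProd (Finset.univ \ {A}) x)
        (Function.update x A a) < ∞) ∧
      lmarginal P.ref (Finset.univ \ T)
        (fun x => ENNReal.ofReal |x Y| * P.kerProd Finset.univ x) x < ∞ := by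
  have hm := P.measurable_comp_mul_kerProd measurable_ofReal_abs Y (Finset.univ \ {A})
  have hm' := P.measurable_comp_mul_kerProd measurable_ofReal_abs Y Finset.univ
  have hset : Finset.univ \ {A} = T ∪ (Finset.univ \ {A}) \ T := by
    rw [Finset.union_sdiff_of_subset]
    intro v hv
    simpa using fun h : v = A => hAT (h ▸ hv)
  have hset' : Finset.univ \ T = {A} ∪ (Finset.univ \ {A}) \ T := by
    ext v
    by_cases hv : v = A
    · simp [hv, hAT]
    · simp [hv]
  have h1 : ∀ a ∈ ({0, 1} : Set ℝ), ∀ᵐ x ∂Measure.pi P.ref,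
      lmarginal P.ref ((Finset.univ \ {A}) \ T)
        (fun x => ENNReal.ofReal |x Y| * P.kerProd (Finset.univ \ {A}) x)
        (Function.update x A a) < ∞ := by
    intro a ha
    set F : (V → ℝ) → ℝ≥0∞ := lmarginal P.ref ((Finset.univ \ {A}) \ T)
      (fun x => ENNReal.ofReal |x Y| * P.kerProd (Finset.univ \ {A}) x) with hF
    have hFm : Measurable F := hm.lmarginal P.ref
    refine ae_lt_top_of_dependsOn (T := T) (F := F ∘ (Function.update · A a)) (x₀ := 0)
      (hFm.comp measurable_update_left) ?_ ?_
    · intro x y h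
      change F (Function.update x A a) = F (Function.update y A a)
      rw [hF]
      refine lmarginal_congr P.ref _ fun i hi => ?_
      by_cases hiA : i = A
      · simp [hiA]
      · have hiT : i ∈ T := by simpa [hiA] using hi
        simpa [hiA] using h i hiT
    · rw [← lmarginal_update_of_notMem hFm hAT, hF,
        ← lmarginal_union P.ref _ hm Finset.disjoint_sdiff, ← hset]
      exact hint a ha
  have h0 : ∀ᵐ x ∂Measure.pi P.ref, ∀ a ∈ ({0, 1} : Set ℝ),
      lmarginal P.ref ((Finset.univ \ {A}) \ T)
        (fun x => ENNReal.ofReal |x Y| * P.kerProd (Finset.univ \ {A}) x)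
        (Function.update x A a) < ∞ := by
    filter_upwards [h1 0 (by simp), h1 1 (by simp)] with x hx0 hx1
    rintro a (rfl | rfl)
    exacts [hx0, hx1]
  refine h0.mono fun x hx => ⟨hx, ?_⟩
  have hle : ∀ a ∈ ({0, 1} : Set ℝ), lmarginal P.ref ((Finset.univ \ {A}) \ T)
      (fun x => ENNReal.ofReal |x Y| * P.kerProd Finset.univ x) (Function.update x A a) < ∞ := by
    intro a ha
    refine lt_of_le_of_lt (lintegral_mono fun y => ?_) (hx a ha)
    dsimp only
    rw [P.kerProd_univ A, ← updateFinset_update (by simp)]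
    refine mul_le_mul_right ?_ _
    exact (mul_le_mul_left (P.kernel_le_one hA ha _) _).trans (one_mul _).le
  rw [hset', lmarginal_union _ _ hm' (Finset.disjoint_singleton_left.2 (by simp)),
    lmarginal_singleton_of_binary hA]
  exact ENNReal.add_lt_top.2 ⟨hle 0 (by simp), hle 1 (by simp)⟩

/-- Homogeneity in terms of unnormalized means: for almost every value of the non-descendants `W`
of `A`, the partial means of `Y` under the two interventions differ by `τ` times the density. -/
theorem ae_homogeneous (hW : ∀ v, v ∈ W ↔ ¬ G.Anc A v) {τ : ℝ}
    (hτ : ∀ᵐ x ∂P.law,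
      condMean P.ref (Finset.univ \ {A}) (P.doDensity {A}) Y W (Function.update x A 1) -
        condMean P.ref (Finset.univ \ {A}) (P.doDensity {A}) Y W (Function.update x A 0) = τ) :
    ∀ᵐ x ∂Measure.pi P.ref,
      coordIntegral P.ref ((Finset.univ \ {A}) \ W) Y (P.kerProd (Finset.univ \ {A}))
          (Function.update x A 1) =
        coordIntegral P.ref ((Finset.univ \ {A}) \ W) Y (P.kerProd (Finset.univ \ {A}))
          (Function.update x A 0) + τ * (P.marg W x).toReal := by
  have hAW : A ∉ W := fun h => (hW A).1 h .refl
  have hWanc : ∀ v ∈ W, ¬ G.Anc A v := fun v hv => (hW v).1 hv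
  have hdm : Measurable P.density := P.density_eq_kerProd ▸ P.measurable_kerProd _
  have hmargA : ∀ x a, P.marg W (Function.update x A a) = P.marg W x := fun x a =>
    apply_update_of_dependsOn (P.dependsOn_marg W) hAW x a
  have hcond : ∀ x a, condMean P.ref (Finset.univ \ {A}) (P.doDensity {A}) Y W
      (Function.update x A a) =
        coordIntegral P.ref ((Finset.univ \ {A}) \ W) Y (P.kerProd (Finset.univ \ {A}))
          (Function.update x A a) / (P.marg W x).toReal := by
    intro x a
    rw [← hmargA x a, ← P.lmarginal_do_eq_marg hWanc]
    rfl
  simp only [hcond] at hτ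
  rw [law, ae_withDensity_iff hdm] at hτ
  filter_upwards [ae_ae_updateFinset hτ (Finset.univ \ W), P.ae_marg_ne_top W] with x hx hfin
  by_cases h0 : P.marg W x = 0
  · have hz : ∀ a, coordIntegral P.ref ((Finset.univ \ {A}) \ W) Y (P.kerProd (Finset.univ \ {A}))
        (Function.update x A a) = 0 := by
      intro a
      have hnull : lmarginal P.ref ((Finset.univ \ {A}) \ W) (P.kerProd (Finset.univ \ {A}))
          (Function.update x A a) = 0 := by
        rw [P.lmarginal_do_eq_marg hWanc, hmargA, h0]
      refine (integral_congr_ae ?_).trans (integral_zero _ _)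
      filter_upwards [ae_eq_zero_of_lmarginal_eq_zero (P.measurable_kerProd _) hnull] with y hy
      simp [hy]
    rw [hz, hz, h0]
    simp
  · obtain ⟨y, hy⟩ : ∃ y : (Finset.univ \ W : Finset V) → ℝ,
        coordIntegral P.ref ((Finset.univ \ {A}) \ W) Y (P.kerProd (Finset.univ \ {A}))
          (Function.update (Function.updateFinset x (Finset.univ \ W) y) A 1) /
            (P.marg W (Function.updateFinset x (Finset.univ \ W) y)).toReal -
        coordIntegral P.ref ((Finset.univ \ {A}) \ W) Y (P.kerProd (Finset.univ \ {A}))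
          (Function.update (Function.updateFinset x (Finset.univ \ W) y) A 0) /
            (P.marg W (Function.updateFinset x (Finset.univ \ W) y)).toReal = τ := by
      by_contra! hcon
      refine h0 ((lintegral_congr_ae ?_).trans lintegral_zero)
      filter_upwards [hx] with y hy
      by_contra hne
      exact hcon y (hy hne)
    have hagree : ∀ i ∈ (W : Set V), Function.updateFinset x (Finset.univ \ W) y i = x i := by
      intro i hi
      have hi' : i ∈ W := hi
      simp [Function.updateFinset, hi']
    have hd := fun a => dependsOn_coordIntegral_update (μ := P.ref) A W Y
      (P.kerProd (Finset.univ \ {A})) a hagree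
    have hne : (P.marg W x).toReal ≠ 0 := ENNReal.toReal_ne_zero.2 ⟨h0, hfin⟩
    simp only [P.dependsOn_marg W hagree] at hy hd
    rw [hd, hd, ← sub_div, div_eq_iff hne] at hy
    linarith

/-- With a homogeneous effect `τ`, the observational partial mean of `Y` given the values of a set
`T` of non-descendants of `A` is the partial mean under `do(A = 0)` plus `τ` times that of `A`. -/
theorem coordIntegral_eq_add (hA : P.ref A = Measure.dirac 0 + Measure.dirac 1)
    (hW : ∀ v, v ∈ W ↔ ¬ G.Anc A v) (hTW : T ⊆ W) {τ : ℝ} {x : V → ℝ}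
    (hτ : ∀ᵐ y ∂Measure.pi (fun i : (W \ T : Finset V) => P.ref i),
      coordIntegral P.ref ((Finset.univ \ {A}) \ W) Y (P.kerProd (Finset.univ \ {A}))
          (Function.update (Function.updateFinset x (W \ T) y) A 1) =
        coordIntegral P.ref ((Finset.univ \ {A}) \ W) Y (P.kerProd (Finset.univ \ {A}))
          (Function.update (Function.updateFinset x (W \ T) y) A 0) +
            τ * (P.marg W (Function.updateFinset x (W \ T) y)).toReal)
    (hfin : lmarginal P.ref (Finset.univ \ T)
      (fun x => ENNReal.ofReal |x Y| * P.kerProd Finset.univ x) x < ∞)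
    (hfin0 : lmarginal P.ref ((Finset.univ \ {A}) \ T)
      (fun x => ENNReal.ofReal |x Y| * P.kerProd (Finset.univ \ {A}) x)
        (Function.update x A 0) < ∞)
    (hmarg : P.marg T x ≠ ∞) :
    coordIntegral P.ref (Finset.univ \ T) Y (P.kerProd Finset.univ) x =
      coordIntegral P.ref ((Finset.univ \ {A}) \ T) Y (P.kerProd (Finset.univ \ {A}))
        (Function.update x A 0) +
      τ * coordIntegral P.ref (Finset.univ \ T) A (P.kerProd Finset.univ) x := by
  have hAW : A ∉ W := fun h => (hW A).1 h .refl
  have hWanc : ∀ v ∈ W, ¬ G.Anc A v := fun v hv => (hW v).1 hv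
  have hAT : A ∉ T := fun h => hAW (hTW h)
  set D := (Finset.univ \ {A}) \ W with hD
  set g := P.kerProd (Finset.univ \ {A})
  set f := P.kerProd Finset.univ with hf
  have hgm : Measurable g := P.measurable_kerProd _
  have hfm : Measurable f := P.measurable_kerProd _
  have hset : Finset.univ \ T = (W \ T) ∪ ({A} ∪ D) := by
    ext v
    by_cases hv : v = A
    · simp [hv, hAT]
    · have := @hTW v
      simp [hv, hD]
      tauto
  have hset0 : (Finset.univ \ {A}) \ T = (W \ T) ∪ D := by
    ext v
    by_cases hv : v = A
    · simp [hv, hAW, hD]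
    · have := @hTW v
      simp [hv, hD]
      tauto
  have hset1 : Finset.univ \ T = {A} ∪ (Finset.univ \ {A}) \ T := by
    ext v
    by_cases hv : v = A
    · simp [hv, hAT]
    · simp [hv]
  have hAD : Disjoint {A} D := Finset.disjoint_singleton_left.2 (by simp [hD])
  have hWD : Disjoint (W \ T) D := Finset.disjoint_sdiff.mono_left Finset.sdiff_subset
  have hWAD : Disjoint (W \ T) ({A} ∪ D) := by
    rw [Finset.disjoint_union_right]
    exact ⟨Finset.disjoint_singleton_right.2 (by simp [hAW]), hWD⟩
  have hkdep : DependsOn (fun z => (P.kernel A z : ℝ≥0∞).toReal) (D : Set V)ᶜ := by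
    have : DependsOn (fun z => (P.kernel A z : ℝ≥0∞)) (D : Set V)ᶜ := by
      refine (P.dependsOn_kernel A).mono ?_
      rintro u hu huD
      have huD' := Finset.mem_sdiff.1 huD
      refine huD'.2 ((hW u).2 fun h => ?_)
      rcases hu with rfl | hu
      · simp at huD'
      · exact G.acyclic A (Relation.TransGen.tail' h hu)
    exact fun y z h => congrArg ENNReal.toReal (this h)
  -- the factor `P(a | pa(A))` comes out of the integral over the descendants of `A`
  have hpull : ∀ v z, coordIntegral P.ref D v f z =
      (P.kernel A z : ℝ≥0∞).toReal * coordIntegral P.ref D v g z := by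
    intro v z
    unfold coordIntegral
    rw [← rmarg_mul_left (F := fun z => (P.kernel A z : ℝ≥0∞).toReal) hkdep]
    congr 1
    funext z
    rw [hf, P.kerProd_univ A, ENNReal.toReal_mul]
    ring
  -- the mean of `A` given the values of `W`
  have hA_int : ∀ z, coordIntegral P.ref D A g z = z A * (P.marg W z).toReal := by
    intro z
    have hdep : DependsOn (fun z : V → ℝ => z A) (D : Set V)ᶜ :=
      (dependsOn_comp_apply id A).mono fun v hv => by
        have hv' : v = A := hv
        simp [hv', hD]
    unfold coordIntegral
    rw [rmarg_mul_left hdep, ← P.lmarginal_do_eq_marg hWanc, rmarg, integral_toReal]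
    · rfl
    · exact (hgm.comp measurable_updateFinset).aemeasurable
    · exact .of_forall fun y => (P.kerProd_ne_top _ _).lt_top
  have hfinA : lmarginal P.ref (Finset.univ \ T) (fun x => ENNReal.ofReal |x A| * f x) x < ∞ := by
    have hdep : DependsOn (fun z : V → ℝ => ENNReal.ofReal |z A|)
        (((Finset.univ \ {A}) \ T : Finset V) : Set V)ᶜ :=
      (dependsOn_comp_apply (fun t => ENNReal.ofReal |t|) A).mono fun v hv => by
        have hv' : v = A := hv
        simp [hv']
    have h : P.marg T x = lmarginal P.ref ((Finset.univ \ {A}) \ T) f (Function.update x A 0) +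
        lmarginal P.ref ((Finset.univ \ {A}) \ T) f (Function.update x A 1) := by
      rw [marg, density_eq_kerProd, hset1, lmarginal_union _ _ hfm
        (Finset.disjoint_singleton_left.2 (by simp)), lmarginal_singleton_of_binary hA]
    rw [hset1, lmarginal_union _ _ (P.measurable_comp_mul_kerProd measurable_ofReal_abs A _)
      (Finset.disjoint_singleton_left.2 (by simp)), lmarginal_singleton_of_binary hA,
      lmarginal_mul_left hdep hfm, lmarginal_mul_left hdep hfm]
    rw [h] at hmarg
    simpa using (ENNReal.add_ne_top.1 hmarg).2.lt_top
  have hinner : ∀ v z, lmarginal P.ref ({A} ∪ D) (fun x => ENNReal.ofReal |x v| * f x) z < ∞ →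
      coordIntegral P.ref ({A} ∪ D) v f z =
        (P.kernel A (Function.update z A 0) : ℝ≥0∞).toReal *
          coordIntegral P.ref D v g (Function.update z A 0) +
        (P.kernel A (Function.update z A 1) : ℝ≥0∞).toReal *
          coordIntegral P.ref D v g (Function.update z A 1) := by
    intro v z hz
    rw [(coordIntegral_union hAD hfm (P.kerProd_ne_top _) hz).1.2, rmarg_singleton_of_binary hA,
      hpull, hpull]
  have hftop : ∀ x, f x ≠ ∞ := P.kerProd_ne_top _
  have hgtop : ∀ x, g x ≠ ∞ := P.kerProd_ne_top _
  rw [hset] at hfin hfinA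
  rw [hset0] at hfin0
  have hUY := coordIntegral_union (μ := P.ref) (v := Y) (x := x) hWAD hfm hftop hfin
  have hUA := coordIntegral_union (μ := P.ref) (v := A) (x := x) hWAD hfm hftop hfinA
  have hU0 := coordIntegral_union (μ := P.ref) (v := Y) (x := Function.update x A 0) hWD hgm hgtop
    hfin0
  rw [hset, hset0, hUY.1.2, hUA.1.2, hU0.1.2]
  unfold rmarg
  rw [← integral_const_mul, ← integral_add hU0.1.1 (hUA.1.1.const_mul τ)]
  refine integral_congr_ae ?_
  filter_upwards [hUY.2, hUA.2, hτ] with y h1 h2 h3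
  rw [hinner Y _ h1, hinner A _ h2, h3, hA_int, hA_int,
    ← updateFinset_update (by simp [hAW])]
  set z : V → ℝ := Function.updateFinset x (W \ T) y
  have hk : (P.kernel A (Function.update z A 0) : ℝ≥0∞).toReal +
      (P.kernel A (Function.update z A 1) : ℝ≥0∞).toReal = 1 := by
    rw [← ENNReal.toReal_add ENNReal.coe_ne_top ENNReal.coe_ne_top, P.kernel_add_kernel hA,
      ENNReal.toReal_one]
  rw [apply_update_of_dependsOn (P.dependsOn_marg W) hAW,
    apply_update_of_dependsOn (P.dependsOn_marg W) hAW, Function.update_self, Function.update_self]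
  linear_combination coordIntegral P.ref D Y g (Function.update z A 0) * hk

end instrument

end CausalModel

/-! ### The instrumental variable formula -/

theorem mem_observed {V : Type*} [DecidableEq V] {Z : V} {C : Finset V} {A : V} {M : Finset V}
    {Y v : V} : v ∈ observed Z C A M Y ↔ v = Z ∨ v = A ∨ v = Y ∨ v ∈ C ∨ v ∈ M := by
  simp only [observed, Finset.mem_union, Finset.mem_insert, Finset.mem_singleton]
  tauto

theorem observed_eq_insert {V : Type*} [DecidableEq V] (Z : V) (C : Finset V) (A : V)
    (M : Finset V) (Y : V) : observed Z C A M Y = insert Y (M ∪ ({A, Z} ∪ C)) := by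
  ext v
  rw [mem_observed]
  simp only [Finset.mem_insert, Finset.mem_union, Finset.mem_singleton]
  tauto

namespace CausalModel

variable {V : Type*} [Fintype V] [DecidableEq V] {G : DAG V} (P : CausalModel G)

section instrument

variable {A Y Z : V} {C W : Finset V}

/-- If `Z` and `Y` are independent given `C` under `do(A = a)`, then the mean of `Y` given `Z` and
`C` is that given `C` alone, at each atom of `Z`. -/
theorem coordIntegral_instrument (hZA : Z ≠ A) (hYA : Y ≠ A) (hAC : A ∉ C) (hZC : Z ∉ C)
    (hYZ : Y ≠ Z) (hC : ∀ v ∈ insert Z C, ¬ G.Anc A v)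
    (hsep : ∀ a, ¬ (G.isolate A).Trail C Z a Y) {x : V → ℝ} (hatom : P.ref Z {x Z} ≠ 0)
    (hfin : lmarginal P.ref ((Finset.univ \ {A}) \ insert Z C)
      (fun x => ENNReal.ofReal |x Y| * P.kerProd (Finset.univ \ {A}) x) x < ∞)
    (hfin' : lmarginal P.ref ((Finset.univ \ {A}) \ C)
      (fun x => ENNReal.ofReal |x Y| * P.kerProd (Finset.univ \ {A}) x) x < ∞) :
    (P.marg C x).toReal * coordIntegral P.ref ((Finset.univ \ {A}) \ insert Z C) Y
        (P.kerProd (Finset.univ \ {A})) x =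
      (P.marg (insert Z C) x).toReal * coordIntegral P.ref ((Finset.univ \ {A}) \ C) Y
        (P.kerProd (Finset.univ \ {A})) x := by
  obtain ⟨α, β, hαβ⟩ := P.exists_factorization (A := A) (X := {Z}) (C := C) (y := Y)
    (by simpa using hZA.symm) hYA hAC (Finset.disjoint_singleton_left.2 hZC) (by simpa using hYZ)
    (by simpa using hsep) x
  have hset : (Finset.univ \ {A}) \ C = insert Z ((Finset.univ \ {A}) \ insert Z C) := by
    ext v
    by_cases hv : v = Z
    · simp [hv, hZA, hZC]
    · simp [hv]
  set ψ : (V → ℝ) → ℝ≥0∞ := fun z => ({x Z} : Set ℝ).indicator (fun _ => 1) (z Z) with hψ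
  have hψm : Measurable ψ :=
    (measurable_const.indicator (measurableSet_singleton _)).comp (measurable_pi_apply Z)
  have hψdep : DependsOn ψ {v | v ∈ ({Z} : Finset V) ∨ v ∈ C ∨ v = A} :=
    (dependsOn_comp_apply _ Z).mono fun v hv => Or.inl (by simpa using hv)
  have h1dep : ∀ T : Set V, DependsOn (fun _ : V → ℝ => (1 : ℝ≥0∞)) T := fun _ _ _ _ => rfl
  have hφdep : ∀ φ : ℝ → ℝ≥0∞, DependsOn (fun x : V → ℝ => φ (x Y)) {v | v = Y ∨ v ∈ C ∨ v = A} :=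
    fun φ => (dependsOn_comp_apply φ Y).mono fun v hv => Or.inl hv
  have hφm : ∀ φ : ℝ → ℝ≥0∞, Measurable φ → Measurable fun x : V → ℝ => φ (x Y) :=
    fun φ hφ => hφ.comp (measurable_pi_apply Y)
  have hC' : ∀ φ : ℝ → ℝ≥0∞, Measurable φ → lmarginal P.ref ((Finset.univ \ {A}) \ C)
      (fun x => φ (x Y) * P.kerProd (Finset.univ \ {A}) x) x =
        α (fun _ => 1) * β (fun x => φ (x Y)) := by
    intro φ hφ
    rw [← hαβ _ _ measurable_const (hφm φ hφ) (h1dep _) (hφdep φ)]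
    simp
  have hZC' : ∀ φ : ℝ → ℝ≥0∞, Measurable φ →
      P.ref Z {x Z} * lmarginal P.ref ((Finset.univ \ {A}) \ insert Z C)
        (fun x => φ (x Y) * P.kerProd (Finset.univ \ {A}) x) x = α ψ * β (fun x => φ (x Y)) := by
    intro φ hφ
    rw [← hαβ _ _ hψm (hφm φ hφ) hψdep (hφdep φ), hset,
      ← lmarginal_insert_indicator (by simp) (P.measurable_comp_mul_kerProd hφ Y _)]
    simp_rw [hψ, mul_assoc]
  have hmargC := hC' (fun _ => 1) measurable_const
  have hmargZC := hZC' (fun _ => 1) measurable_const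
  simp only [one_mul] at hmargC hmargZC
  rw [P.lmarginal_do_eq_marg fun v hv => hC v (Finset.mem_insert_of_mem hv)] at hmargC
  rw [P.lmarginal_do_eq_marg hC] at hmargZC
  refine rmarg_transport (P.measurable_kerProd _) (P.measurable_kerProd _)
    (P.kerProd_ne_top _) (P.kerProd_ne_top _) hfin hfin' fun φ hφ => ?_
  have hr : P.ref Z {x Z} ≠ ∞ := measure_singleton_lt_top.ne
  rw [← ENNReal.mul_right_inj hatom hr]
  calc P.ref Z {x Z} * (P.marg C x * lmarginal P.ref ((Finset.univ \ {A}) \ insert Z C)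
        (fun x => φ (x Y) * P.kerProd (Finset.univ \ {A}) x) x)
      = P.marg C x * (P.ref Z {x Z} * lmarginal P.ref ((Finset.univ \ {A}) \ insert Z C)
        (fun x => φ (x Y) * P.kerProd (Finset.univ \ {A}) x) x) := by ring
    _ = (P.ref Z {x Z} * P.marg (insert Z C) x) * lmarginal P.ref ((Finset.univ \ {A}) \ C)
        (fun x => φ (x Y) * P.kerProd (Finset.univ \ {A}) x) x := by
      rw [hZC' φ hφ, hC' φ hφ, hmargC, hmargZC]
      ring
    _ = _ := by ring

/-- The instrumental variable formula: if the effect is homogeneous, and `Z` is independent of `Y`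
given `C` under interventions on `A`, then `E[Y | z, c] = E[Y | do(A = 0), c] + τ E[A | z, c]`. -/
theorem ace_eq_wald {obs : Finset V}
    (hA : P.ref A = Measure.dirac 0 + Measure.dirac 1) (hpos : P.Positive obs)
    (hobs : insert Z C ⊆ obs) (hint : ∀ a ∈ ({0, 1} : Set ℝ), P.DoIntegrable A Y a)
    (hYA : Y ≠ A) (hZC : Z ∉ C) (hYZ : Y ≠ Z)
    (hC : ∀ v ∈ insert Z C, ¬ G.Anc A v) (hsep : ∀ a, ¬ (G.isolate A).Trail C Z a Y)
    (hZ0 : P.ref Z {0} ≠ 0) (hZ1 : P.ref Z {1} ≠ 0) (hhom : P.HomogeneousEffect A Y)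
    (hden : P.instrumentContrast Z A C ≠ 0) :
    P.ace A Y = P.wald Z A Y C := by
  classical
  obtain ⟨τ, hτ⟩ := hhom
  set W : Finset V := Finset.univ.filter fun v => ¬ G.Anc A v with hWdef
  have hW : ∀ v, v ∈ W ↔ ¬ G.Anc A v := fun v => by simp [hWdef]
  have hτ' := P.ae_homogeneous (Y := Y) hW (τ := τ) (by convert hτ)
  have hAW : A ∉ W := fun h => (hW A).1 h .refl
  have hAZC : A ∉ insert Z C := fun h => hC A h .refl
  have hAC : A ∉ C := fun h => hAZC (Finset.mem_insert_of_mem h)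
  have hZA : Z ≠ A := fun h => hAZC (by simp [h])
  have hTW : insert Z C ⊆ W := fun v hv => (hW v).2 (hC v hv)
  -- the average causal effect is `τ`
  have hace : P.ace A Y = τ := by
    rw [P.ace_eq_integral hint hAW]
    have hdep : DependsOn (fun x => coordIntegral P.ref ((Finset.univ \ {A}) \ W) Y
          (P.kerProd (Finset.univ \ {A})) (Function.update x A 1) =
        coordIntegral P.ref ((Finset.univ \ {A}) \ W) Y (P.kerProd (Finset.univ \ {A}))
          (Function.update x A 0) + τ * (P.marg W x).toReal) (W : Set V) := by
      intro x y h
      have hd := fun a => dependsOn_coordIntegral_update (μ := P.ref) A W Y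
        (P.kerProd (Finset.univ \ {A})) a h
      simp only at hd
      simp only [hd, P.dependsOn_marg W h]
    have hae := ae_updateFinset P.ref_ne_zero hτ' W W hdep 0 fun i hi hi' => absurd hi hi'
    have htot : lmarginal P.ref W (P.marg W) 0 = 1 := by
      have h := P.lmarginal_marg (Finset.empty_subset W) 0
      rwa [Finset.sdiff_empty, marg_empty] at h
    calc _ = ∫ y : W → ℝ, τ * (P.marg W (Function.updateFinset 0 W y)).toReal
          ∂Measure.pi fun i : W => P.ref i := by
          refine integral_congr_ae ?_
          filter_upwards [hae] with y hy
          rw [← updateFinset_update hAW, ← updateFinset_update hAW, hy]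
          ring
      _ = τ * (lmarginal P.ref W (P.marg W) 0).toReal := by
          rw [integral_const_mul, integral_toReal]
          · rfl
          · exact ((P.measurable_marg W).comp measurable_updateFinset).aemeasurable
          · exact ae_lt_top_of_lmarginal_lt_top (P.measurable_marg W)
              (by rw [htot]; exact ENNReal.one_lt_top)
      _ = τ := by rw [htot]; simp
  -- given `C`, the mean of `Y` minus `τ` times the mean of `A` is the same at all atoms of `Z`
  have hmean : ∀ᵐ x ∂Measure.pi P.ref, P.ref Z {x Z} ≠ 0 →
      P.mean Y (insert Z C) x - τ * P.mean A (insert Z C) x =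
        coordIntegral P.ref ((Finset.univ \ {A}) \ C) Y (P.kerProd (Finset.univ \ {A}))
          (Function.update x A 0) / (P.marg C x).toReal := by
    filter_upwards [ae_ae_updateFinset hτ' (W \ insert Z C), P.ae_integrable hA hint hAZC,
      P.ae_integrable hA hint hAC, P.ae_marg hpos hobs,
      P.ae_marg hpos ((Finset.subset_insert Z C).trans hobs)] with x h1 h2 h3 h4 h5 hatom
    have hE := P.coordIntegral_eq_add hA hW hTW h1 h2.2 (h2.1 0 (by simp)) h4.2
    have hI := P.coordIntegral_instrument (x := Function.update x A 0) hZA hYA hAC hZC hYZ hC hsep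
      (by simpa [hZA] using hatom) (h2.1 0 (by simp)) (h3.1 0 (by simp))
    rw [apply_update_of_dependsOn (P.dependsOn_marg _) hAC,
      apply_update_of_dependsOn (P.dependsOn_marg _) hAZC] at hI
    have hq := ENNReal.toReal_ne_zero.2 h4
    have hp := ENNReal.toReal_ne_zero.2 h5
    rw [mean_eq_div, mean_eq_div, hE, ← mul_div_assoc, ← sub_div, add_sub_cancel_right,
      div_eq_div_iff hq hp]
    linear_combination hI
  have hdep : DependsOn (fun x : V → ℝ => P.ref Z {x Z} ≠ 0 →
      P.mean Y (insert Z C) x - τ * P.mean A (insert Z C) x =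
        coordIntegral P.ref ((Finset.univ \ {A}) \ C) Y (P.kerProd (Finset.univ \ {A}))
          (Function.update x A 0) / (P.marg C x).toReal) (insert Z C : Finset V) := by
    intro x y h
    have hCsub : ∀ i ∈ (C : Set V), x i = y i := fun i hi =>
      h i (Finset.mem_coe.2 (Finset.mem_insert_of_mem hi))
    have hd := dependsOn_coordIntegral_update (μ := P.ref) A C Y
      (P.kerProd (Finset.univ \ {A})) 0 hCsub
    have hdm : ∀ v, P.mean v (insert Z C) x = P.mean v (insert Z C) y := fun v => by
      rw [mean_eq_div, mean_eq_div, P.dependsOn_marg _ h,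
        dependsOn_coordIntegral (μ := P.ref) (Finset.univ \ insert Z C) v (P.kerProd Finset.univ)
          fun i hi => h i (by
            by_contra hcon
            exact hi (Finset.mem_coe.2 (Finset.mem_sdiff.2 ⟨Finset.mem_univ i, hcon⟩)))]
    have hZeq : x Z = y Z := h Z (by simp)
    simp only at hd
    simp only [hd, hdm, P.dependsOn_marg C hCsub, hZeq]
  have hatom : ∀ b, P.ref Z {b} ≠ 0 → ∀ᵐ y ∂Measure.pi (fun i : C => P.ref i),
      P.mean Y (insert Z C) (Function.update (Function.updateFinset 0 C y) Z b) -
          τ * P.mean A (insert Z C) (Function.update (Function.updateFinset 0 C y) Z b) =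
        coordIntegral P.ref ((Finset.univ \ {A}) \ C) Y (P.kerProd (Finset.univ \ {A}))
          (Function.update (Function.updateFinset 0 C y) A 0) /
            (P.marg C (Function.updateFinset 0 C y)).toReal := by
    intro b hb
    have hx : ∀ i ∈ insert Z C, i ∉ C → P.ref i {@Function.update V (fun _ => ℝ) _ 0 Z b i} ≠ 0 :=
      fun i hi hi' => by
        rcases Finset.mem_insert.1 hi with rfl | h
        · simpa using hb
        · exact absurd h hi'
    filter_upwards [ae_updateFinset P.ref_ne_zero hmean C (insert Z C) hdep
      (Function.update 0 Z b) hx] with y hy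
    rw [← updateFinset_update hZC] at hy
    rw [hy (by simpa using hb), apply_update_of_dependsOn (P.dependsOn_marg C) hZC]
    congr 1
    exact apply_update_of_dependsOn (dependsOn_coordIntegral_update (μ := P.ref) A C Y
      (P.kerProd (Finset.univ \ {A})) 0) hZC _ b
  have hcontrast : P.instrumentContrast Z Y C = τ * P.instrumentContrast Z A C := by
    unfold instrumentContrast rmarg
    rw [← integral_const_mul]
    refine integral_congr_ae ?_
    filter_upwards [hatom 0 hZ0, hatom 1 hZ1] with y h0 h1
    linear_combination (P.marg C (Function.updateFinset 0 C y)).toReal * (h1 - h0)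
  rw [hace, wald, hcontrast, mul_div_cancel_right₀ _ hden]

end instrument

end CausalModel

/-! ### Separation in the intervened graphs -/

/-- A walk from `Z` avoiding `A` that is open given `C` never reaches a mediator, since `M` and `Z`
are separated given `A` and `C`; it is therefore open in the graph under `do(m)`, where it does not
lead to `Y`. -/
theorem DAG.not_trail_of_dSep {V : Type*} [DecidableEq V] {G : DAG V} {Z A Y : V}
    {C M : Finset V} (hZM : Z ∉ M) (hMC : ∀ m ∈ M, ∀ c ∈ C, ¬ G.Anc m c)
    (hM : G.DSep {Z} M (insert A C)) (hY : (G.doGraph M).DSep {Z} {Y} (C ∪ M)) (a : V) :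
    ¬ (G.isolate A).Trail C Z a Y := by
  suffices H : ∀ b c, (G.isolate A).Trail C Z b c → b ∉ M ∧ c ∉ M ∧
      G.Trail (insert A C) Z b c ∧ (G.doGraph M).Trail (C ∪ M) Z b c from
    fun h => hY.not_trail (by simp) (by simp) (H a Y h).2.2.2
  have hdoadj : ∀ {u v}, u ∉ M → v ∉ M → ((G.isolate A).Adj u v ∨ (G.isolate A).Adj v u) →
      (G.doGraph M).Adj u v ∨ (G.doGraph M).Adj v u := fun hu hv h =>
    h.imp (fun h => ⟨h.1, hv⟩) fun h => ⟨h.1, hu⟩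
  have hdoanc : ∀ {b c}, c ∈ C → G.Anc b c → (G.doGraph M).Anc b c := by
    intro b c hc h
    induction h using Relation.ReflTransGen.head_induction_on with
    | refl => exact .refl
    | @head u v huv hvc ih => exact .head ⟨huv, fun hv => hMC v hv c hc hvc⟩ ih
  intro b c h
  induction h with
  | @edge b h =>
    have ht : G.Trail (insert A C) Z Z b := .edge (h.imp (fun h => h.1) fun h => h.1)
    have hb : b ∉ M := fun hb => hM.not_trail (by simp) hb ht
    exact ⟨hZM, hb, ht, .edge (hdoadj hZM hb h)⟩
  | @step a b c h hbc hcol hnon ih =>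
    obtain ⟨haM, hbM, htr, htr'⟩ := ih
    have hab : a ≠ A ∧ b ≠ A := by
      rcases h.adj with h | h
      · exact h.2
      · exact h.2.symm
    have hcA : c ≠ A := by
      rcases hbc with h | h
      · exact h.2.2
      · exact h.2.1
    have hcoll : G.Adj a b ∧ G.Adj c b → ∃ w ∈ C, G.Anc b w := fun h' => by
      obtain ⟨w, hw, hbw⟩ := hcol ⟨⟨h'.1, hab⟩, h'.2, hcA, hab.2⟩
      exact ⟨w, hw, DAG.anc_of_anc_isolate hbw⟩
    have hnonc : ¬ (G.Adj a b ∧ G.Adj c b) → b ∉ C := fun h' =>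
      hnon fun h'' => h' ⟨h''.1.1, h''.2.1⟩
    have ht : G.Trail (insert A C) Z b c := by
      refine htr.step (hbc.imp (fun h => h.1) fun h => h.1) (fun h' => ?_) fun h' => ?_
      · obtain ⟨w, hw, hbw⟩ := hcoll h'
        exact ⟨w, by simp [hw], hbw⟩
      · simp [hnonc h', hab.2]
    have hc : c ∉ M := fun hc => hM.not_trail (by simp) hc ht
    refine ⟨hbM, hc, ht, htr'.step (hdoadj hbM hc hbc) (fun h' => ?_) fun h' => ?_⟩
    · obtain ⟨w, hw, hbw⟩ := hcoll ⟨h'.1.1, h'.2.1⟩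
      exact ⟨w, by simp [hw], hdoanc hw hbw⟩
    · simp [hnonc fun h'' => h' ⟨⟨h''.1, hbM⟩, h''.2, hbM⟩, hbM]

/-- If `Y` and `Z` are separated under `do(m)`, then `A` affects `Y` only through the mediators:
a directed path from `A` to `Y` avoiding `M` would be prolonged by the edge `Z → A` to an open
walk. -/
theorem DAG.not_anc_doGraph_of_dSep {V : Type*} [DecidableEq V] {G : DAG V} {Z A Y : V}
    {C M : Finset V} (hZA : G.Adj Z A) (hAM : A ∉ M) (hC : ∀ c ∈ C, ¬ G.Anc A c)
    (hY : (G.doGraph M).DSep {Z} {Y} (C ∪ M)) : ¬ (G.doGraph M).Anc A Y := by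
  suffices H : ∀ b, (G.doGraph M).Anc A b →
      ∃ a, (G.doGraph M).Trail (C ∪ M) Z a b ∧ (G.doGraph M).Adj a b from
    fun h => (H Y h).elim fun a ha => hY.not_trail (by simp) (by simp) ha.1
  intro b h
  induction h with
  | refl => exact ⟨Z, .edge (Or.inl ⟨hZA, hAM⟩), hZA, hAM⟩
  | @tail b c hAb hbc ih =>
    obtain ⟨a, ha, hab⟩ := ih
    refine ⟨b, ha.step (Or.inl hbc)
      (fun h => absurd h.2 ((G.doGraph M).not_adj_of_adj hbc)) fun _ hb => ?_, hbc⟩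
    rcases Finset.mem_union.1 hb with hb | hb
    · exact hC b hb (DAG.anc_of_anc_doGraph hAb)
    · exact hab.2 hb

end Causal

/-! ### The three identification formulas -/

theorem proposition2 {V : Type*} [Fintype V] [DecidableEq V]
    (G : Causal.DAG V) (P : Causal.CausalModel G)
    (Z : V) (C : Finset V) (A : V) (M : Finset V) (Y : V) (hZC : Z ∉ C)
    -- the treatment is binary, the observed density positive, and the effect well defined
    (hA : P.ref A = Measure.dirac 0 + Measure.dirac 1)
    (hpos : P.Positive (Causal.observed Z C A M Y))
    (hint : ∀ a ∈ ({0, 1} : Set ℝ), P.DoIntegrable A Y a)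
    -- faithfulness, ordinary and for the Verma constraint in question
    (hfaithful : P.Faithful (Causal.observed Z C A M Y))
    (hverma : P.VermaFaithful (Causal.observed Z C A M Y) M ({A, Z} ∪ C) {Y} {Z} C)
    -- causal ordering
    (hord : G.Ordered Z C A M Y)
    -- the edges Z → A → M → Y
    (hZA : G.Adj Z A) (hAM : ∃ m ∈ M, G.Adj A m) (hMY : ∃ m ∈ M, G.Adj m Y)
    -- a latent variable that causes M also causes Y
    (hlatent : ∀ u ∉ Causal.observed Z C A M Y, ∀ m ∈ M,
      G.Causes (Causal.observed Z C A M Y) u m → G.Causes (Causal.observed Z C A M Y) u Y)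
    -- the parameters
    (β₁ β₂ β₃ : ℝ)
    (hβ₁ : β₁ = 0 ↔ P.CondIndep {Y} {Z} (insert A C))
    (hβ₂ : β₂ = 0 ↔
      P.VermaCondIndep (Causal.observed Z C A M Y) M ({A, Z} ∪ C) {Y} {Z} C)
    (hβ₃ : β₃ = 0 ↔ P.CondIndep M {Z} (insert A C)) :
    (β₁ = 0 → P.ace A Y = P.backdoor A Y C) ∧
    (β₂ = 0 → P.ace A Y = P.frontdoor A M Y (insert Z C)) ∧
    (β₂ = 0 → β₃ = 0 →
      -- Z takes the values 0 and 1, the effect is homogeneous, and the ratio is defined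
      P.ref Z {0} ≠ 0 → P.ref Z {1} ≠ 0 → P.HomogeneousEffect A Y →
      P.instrumentContrast Z A C ≠ 0 →
      P.ace A Y = P.wald Z A Y C) := by
  have hZobs : Z ∈ Causal.observed Z C A M Y := Causal.mem_observed.2 (Or.inl rfl)
  have hAobs : A ∈ Causal.observed Z C A M Y := Causal.mem_observed.2 (by simp)
  have hYobs : Y ∈ Causal.observed Z C A M Y := Causal.mem_observed.2 (by simp)
  have hCobs : C ⊆ Causal.observed Z C A M Y := fun v hv => Causal.mem_observed.2 (by simp [hv])
  have hMobs : M ⊆ Causal.observed Z C A M Y := fun v hv => Causal.mem_observed.2 (by simp [hv])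
  obtain ⟨t, ht, htZ, htC, htM, htY⟩ := hord
  obtain ⟨m₀, hm₀, -⟩ := hAM
  have htAY : t A < t Y := (htM _ hm₀).trans (htY _ hm₀)
  have hne : ∀ {u v}, t u < t v → u ≠ v := fun h h' => h.ne (congrArg t h')
  have hnotAnc : ∀ {u v}, t u < t v → ¬ G.Anc v u := fun h h' => (Causal.DAG.le_of_anc ht h').not_gt h
  have hAC : A ∉ C := fun h => (htC A h).ne rfl
  have hAM : A ∉ M := fun h => (htM A h).ne rfl
  have hYM : Y ∉ M := fun h => (htY Y h).ne rfl
  have hYC : Y ∉ C := fun h => (htC Y h).not_gt htAY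
  have hZM : Z ∉ M := fun h => (htM Z h).not_gt htZ
  have hYA : Y ≠ A := (hne htAY).symm
  have hYZ : Y ≠ Z := (hne (htZ.trans htAY)).symm
  have hZA' : Z ≠ A := hne htZ
  have hCM : Disjoint C M := Finset.disjoint_left.2 fun v hv hv' => (htC v hv).not_gt (htM v hv')
  have hZC' : ∀ v ∈ insert Z C, t v < t A := fun v hv => by
    rcases Finset.mem_insert.1 hv with rfl | hv
    exacts [htZ, htC v hv]
  have hACobs : insert A C ⊆ Causal.observed Z C A M Y := Finset.insert_subset hAobs hCobs
  refine ⟨fun h₁ => ?_, fun h₂ => ?_, fun h₂ h₃ hZ0 hZ1 hhom hden => ?_⟩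
  · have hsep := hfaithful {Y} {Z} (insert A C) (by simpa using hYobs) (by simpa using hZobs) hACobs
      (by simpa using hYZ) (by simp [hYA, hYC]) (by simp [hZA', hZC]) (hβ₁.1 h₁)
    exact P.ace_eq_backdoor hA hpos hACobs hint hYA hAC (fun h => (ht _ _ h).not_gt htAY)
      (fun c hc => hnotAnc (htC c hc)) fun p hp hpC => Causal.DAG.not_trail_of_collider hZA hsep.symm hp hpC
  · obtain ⟨hsupp, hsep⟩ := hverma (hβ₂.1 h₂)
    have hML : ∀ v ∈ M, v ∉ insert Z C := fun v hv hv' => (hZC' v hv').not_gt (htM v hv)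
    -- a latent parent of a mediator would also cause `Y`, which the g-formula excludes
    have hpa : ∀ m ∈ M, ∀ u, G.Adj u m → u ∈ insert A (M ∪ insert Z C) := by
      intro m hm u hum
      have huobs : u ∈ Causal.observed Z C A M Y := by
        by_contra hu
        refine hsupp.not_causes (Causal.observed_eq_insert Z C A M Y) hYM (by simp [hYA, hYZ, hYC]) ?_ hu hm hum
          (hlatent u hu m hm ⟨u, .refl, hum⟩)
        refine Finset.disjoint_left.2 fun v hv hv' => ?_
        simp only [Finset.mem_union, Finset.mem_insert, Finset.mem_singleton] at hv'
        rcases hv' with (rfl | rfl) | hv'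
        exacts [hAM hv, hZM hv, Finset.disjoint_left.1 hCM hv' hv]
      have huY : u ≠ Y := hne ((ht _ _ hum).trans (htY m hm))
      rcases Causal.mem_observed.1 huobs with h | h | h | h | h
      · simp [h]
      · simp [h]
      · exact absurd h huY
      · simp [h]
      · simp [h]
    refine P.ace_eq_frontdoor hA hpos (fun v hv => ?_) hint hAM (fun h => (hZC' A h).ne rfl)
      (Finset.disjoint_left.2 hML) hYM hpa ?_ (fun v hv => hnotAnc (hZC' v hv))
      (Causal.DAG.not_anc_doGraph_of_dSep hZA hAM (fun c hc => hnotAnc (htC c hc)) hsep.symm)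
    · simp only [Finset.mem_insert, Finset.mem_union] at hv
      rcases hv with h | h | h | h
      exacts [Causal.mem_observed.2 (by simp [h]), hMobs h, h ▸ hZobs, hCobs h]
    · intro m hm v hv
      rcases Finset.mem_insert.1 hv with rfl | hv
      · exact hnotAnc (htM m hm)
      · exact hnotAnc ((hZC' v hv).trans (htM m hm))
  · have hsepM := hfaithful M {Z} (insert A C) hMobs (by simpa using hZobs) hACobs
      (by simpa using hZM) (by simp [hAM, hCM.symm]) (by simp [hZA', hZC]) (hβ₃.1 h₃)
    exact P.ace_eq_wald hA hpos (Finset.insert_subset hZobs hCobs) hint hYA hZC hYZ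
      (fun v hv => hnotAnc (hZC' v hv))
      (Causal.DAG.not_trail_of_dSep hZM (fun m hm c hc => hnotAnc ((htC c hc).trans (htM m hm))) hsepM.symm
        (hverma (hβ₂.1 h₂)).2.symm) hZ0 hZ1 hhom hden
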